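/- Let $\Omega\subset\mathbb R^3$ be a bounded open set with Lipschitz boundary $\Sigma=\partial\Omega$ and exterior unit normal $\mathbf n$ (which exists almost everywhere on $\Sigma$ with respect to surface measure), and let $\mu>0$. For $Q,P\in\mathbb R^3$ put $\mathbf R=Q-P$, $r=\|\mathbf R\|$, and $$\mathcal U_{kj}(Q,P)=\frac1{8\pi\mu}\Big[\frac{\delta_{kj}}r+\frac{R_kR_j}{r^3}\Big],\qquad \mathcal H_{kj}(Q,P)=\frac1{32\pi\mu^2}\Big[3r\,\delta_{kj}-\frac{R_kR_j}r\Big].$$ Let $\mathcal F:\overline\Omega\to\mathbb R^3$ be continuous, and let $\mathcal F^0:\overline\Omega\to\mathbb R^3$ be continuously differentiable on $\overline\Omega$ and harmonic in $\Omega$ ($\nabla^2\mathcal F^0=0$ componentwise), with $\mathcal F^0=\mathcal F$ on $\Sigma$. Repeated indices $j$ are summed over $1,2,3$; derivatives and integrals are taken in the variable $Q$. Then for every $P\in\mathbb R^3$ and every $k\in\{1,2,3\}$ all integrals below converge absolutely, and $$\int_\Omega \mathcal U_{kj}\mathcal F_j\,d\Omega=\mu\int_\Omega\nabla^2\mathcal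 H_{kj}\,\mathcal F^0_j\,d\Omega+\int_\Omega \mathcal U_{kj}(\mathcal F_j-\mathcal F^0_j)\,d\Omega,$$ $$\mu\int_\Omega\nabla^2\mathcal H_{kj}\,\mathcal F^0_j\,d\Omega=\mu\int_\Sigma\Big(\frac{\partial\mathcal H_{kj}}{\partial\mathbf n}\mathcal F^0_j-\mathcal H_{kj}\frac{\partial\mathcal F^0_j}{\partial\mathbf n}\Big)d\Sigma,$$ and hence $$\int_\Omega \mathcal U_{kj}\mathcal F_j\,d\Omega=\mu\int_\Sigma\Big(\frac{\partial\mathcal H_{kj}}{\partial\mathbf n}\mathcal F^0_j-\mathcal H_{kj}\frac{\partial\mathcal F^0_j}{\partial\mathbf n}\Big)d\Sigma+\int_\Omega \mathcal U_{kj}(\mathcal F_j-\mathcal F^0_j)\,d\Omega.$$ Moreover, $\mathcal F-\mathcal F^0$ vanishes on $\Sigma$, and its extension by zero outside $\Omega$ is continuous on all of $\mathbb R^3$. Consequently the integrand $\mathcal U_{kj}(\mathcal F_j-\mathcal F^0_j)$ of the remainder vanishes on $\Sigma\setminus\{P\}$, and its extension by zero is continuous on $\mathbb R^3\setminus\{P\}$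 (and, when $P\notin\overline\Omega$, on all of $\mathbb R^3$). For every closed box $\mathcal B=[a_1,b_1]\times[a_2,b_2]\times[a_3,b_3]\supseteq\Omega$, the integral over $\mathcal B$ of this extended integrand converges absolutely and equals $\int_\Omega \mathcal U_{kj}(\mathcal F_j-\mathcal F^0_j)\,d\Omega$. -/

import Mathlib

open MeasureTheory InnerProductSpace Laplacian

noncomputable section

/-- Physical space `ℝ³` with its Euclidean norm. -/
abbrev E3 : Type := EuclideanSpace ℝ (Fin 3)

/-- The Stokeslet `𝓤_{kj}(Q, P) = (1 / 8πμ) (δ_{kj} / r + R_k R_j / r³)`,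
where `R = Q - P` and `r = ‖R‖`. -/
def stokeslet (μ : ℝ) (k j : Fin 3) (Q P : E3) : ℝ :=
  1 / (8 * Real.pi * μ) *
    ((if k = j then 1 else 0) / ‖Q - P‖ + (Q - P) k * (Q - P) j / ‖Q - P‖ ^ 3)

/-- The kernel `𝓗_{kj}(Q, P) = (1 / 32πμ²) (3 r δ_{kj} - R_k R_j / r)`
(its value at `Q = P` is `0`, which makes it continuous). -/
def kernelH (μ : ℝ) (k j : Fin 3) (Q P : E3) : ℝ :=
  1 / (32 * Real.pi * μ ^ 2) *
    (3 * ‖Q - P‖ * (if k = j then 1 else 0) - (Q - P) k * (Q - P) j / ‖Q - P‖)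

/-- A Lipschitz domain: a bounded open subset of `ℝ³` which, near each of its boundary points and
after an orthogonal change of coordinates, is the set of points strictly below the graph of
a Lipschitz function of two variables. -/
structure IsLipschitzDomain (Ω : Set E3) : Prop where
  isOpen : IsOpen Ω
  isBounded : Bornology.IsBounded Ω
  localGraph : ∀ p ∈ frontier Ω, ∃ (e : E3 ≃ₗᵢ[ℝ] E3) (g : EuclideanSpace ℝ (Fin 2) → ℝ)
    (K : NNReal) (r : ℝ), LipschitzWith K g ∧ 0 < r ∧
      ∀ x ∈ Metric.ball p r, x ∈ Ω ↔ (e x) 2 < g !₂[(e x) 0, (e x) 1]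

/-- `n` is the exterior unit normal of `Ω` at the boundary point `Q`: close to `Q`, and outside
any given cone around the plane through `Q` orthogonal to `n`, the points on the side of `-n`
belong to `Ω` and those on the side of `n` do not. There is at most one such `n`. -/
def IsExteriorUnitNormal (Ω : Set E3) (Q n : E3) : Prop :=
  ‖n‖ = 1 ∧ ∀ ε > 0, ∃ δ > 0, ∀ x ∈ Metric.ball Q δ,
    (inner ℝ (x - Q) n < -ε * ‖x - Q‖ → x ∈ Ω) ∧ (ε * ‖x - Q‖ < inner ℝ (x - Q) n → x ∉ Ω)

open Classical in
/-- The exterior unit normal of `Ω` at `Q` (and `0` where there is none). -/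
def exteriorNormal (Ω : Set E3) (Q : E3) : E3 :=
  if h : ∃ n, IsExteriorUnitNormal Ω Q n then h.choose else 0

/-- Surface measure on `Σ = ∂Ω`: the two-dimensional Hausdorff measure, normalised so as to be
area on planes. -/
def surfaceMeasure (Ω : Set E3) : Measure E3 :=
  (μHE[2] : Measure E3).restrict (frontier Ω)

/-- `∂𝓗_{kj}/∂n (Q, P)`, the derivative being with respect to `Q`. -/
def normalDerivH (Ω : Set E3) (μ : ℝ) (k j : Fin 3) (Q P : E3) : ℝ :=
  fderiv ℝ (fun Q' => kernelH μ k j Q' P) Q (exteriorNormal Ω Q)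

/-- The (one-sided, interior) normal derivative `∂f/∂n` at a boundary point of `Ω` of a field `f`
that is continuously differentiable on the closure of `Ω`. -/
def normalDeriv (Ω : Set E3) (f : E3 → E3) (Q : E3) : E3 :=
  fderivWithin ℝ f (closure Ω) Q (exteriorNormal Ω Q)

/-- The integrand `∂_n𝓗_{kj} f_j - 𝓗_{kj} ∂_n f_j` (summed over `j`). -/
def boundaryIntegrand (Ω : Set E3) (μ : ℝ) (f : E3 → E3) (k : Fin 3) (P Q : E3) : ℝ :=
  ∑ j, (normalDerivH Ω μ k j Q P * f Q j - kernelH μ k j Q P * normalDeriv Ω f Q j)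

/-- The integrand `𝓤_{kj} f_j` (summed over `j`). -/
def volumeIntegrand (μ : ℝ) (f : E3 → E3) (k : Fin 3) (P Q : E3) : ℝ :=
  ∑ j, stokeslet μ k j Q P * f Q j

/-- The integrand `∇²𝓗_{kj} f_j` (summed over `j`), the Laplacian being with respect to `Q`. -/
def laplacianIntegrand (μ : ℝ) (f : E3 → E3) (k : Fin 3) (P Q : E3) : ℝ :=
  ∑ j, (Δ (fun Q' => kernelH μ k j Q' P)) Q * f Q j

/-- The closed box `[a₀, b₀] × [a₁, b₁] × [a₂, b₂]`. -/
def closedBox (a b : E3) : Set E3 := {x | ∀ i, a i ≤ x i ∧ x i ≤ b i}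

/-- The field `F - F₀` on `Ω`, extended by zero to all of `ℝ³`. -/
def zeroExtension (Ω : Set E3) (F F₀ : E3 → E3) : E3 → E3 :=
  Ω.indicator (fun Q => F Q - F₀ Q)

end

noncomputable section

open Set Filter Topology Metric
open scoped ENNReal NNReal Manifold ContDiff

/-! Away from the pole, `𝓤_{kj} = μ∇²𝓗_{kj}` (`stokeslet_eq_mul_regKernelHLaplacian`). Writing `F =
F₀ + (F - F₀)` therefore splits the volume integral, and since `F₀` is harmonic, Green's second
identity turns the first term into a boundary integral. Two things need work: the singularity of the
kernel and the roughness of the boundary.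

For the singularity, `r` is replaced in `𝓗` by `√(r² + ε²)`. For `ε ≠ 0` the kernel is `C²` on all
of space and the ordinary Green identity applies (`IsLipschitzDomain.integral_laplacian_mul`). As `ε
→ 0` the Laplacian is dominated by a multiple of `1/r`, which is integrable in dimension three, and
the boundary terms by a constant on a finite measure. Dominated convergence gives
`integral_laplacian_kernelH_mul`, with no ball cut out and no distinction between `P` inside,
outside or on the boundary.

For the boundary, Green's identity rests on the divergence theorem
`IsLipschitzDomain.integral_divergence` for fields continuous on the closure, `C¹` inside and with
integrable divergence. A partition of unity reduces it to a region below a Lipschitz graph. There a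
direction is split into a part tangent to the graph, whose derivative integrates to zero, and a
vertical part, handled by the fundamental theorem of calculus; fields that are `C¹` only in the
interior are reached by lowering the graph. The area formula
`euclideanHausdorffMeasure_restrict_graph` identifies the resulting integral over the plane with one
against Hausdorff measure, and Rademacher's theorem supplies the normal almost everywhere.

The statements on the zero extension follow from `F₀ = F` on the boundary: the indicator of a field
vanishing on the frontier is continuous. -/

/-! ### Horizontal and vertical coordinates, graphs. -/

/-- The plane of the horizontal coordinates. -/
abbrev E2 : Type := EuclideanSpace ℝ (Fin 2)

/-- The point of `ℝ³` with horizontal coordinates `x` and height `t`. -/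
def liftPoint (x : E2) (t : ℝ) : E3 := !₂[x 0, x 1, t]

@[simp] lemma liftPoint_zero (x : E2) (t : ℝ) : liftPoint x t 0 = x 0 := rfl
@[simp] lemma liftPoint_one (x : E2) (t : ℝ) : liftPoint x t 1 = x 1 := rfl
@[simp] lemma liftPoint_two (x : E2) (t : ℝ) : liftPoint x t 2 = t := rfl

/-- The horizontal coordinates of a point of `ℝ³`. -/
def horizontal (y : E3) : E2 := !₂[y 0, y 1]

@[simp] lemma horizontal_zero (y : E3) : horizontal y 0 = y 0 := rfl
@[simp] lemma horizontal_one (y : E3) : horizontal y 1 = y 1 := rfl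

@[simp] lemma horizontal_liftPoint (x : E2) (t : ℝ) : horizontal (liftPoint x t) = x := by
  ext i; fin_cases i <;> rfl

@[simp] lemma liftPoint_horizontal (y : E3) : liftPoint (horizontal y) (y 2) = y := by
  ext i; fin_cases i <;> rfl

lemma liftPoint_sub (x y : E2) (s t : ℝ) :
    liftPoint x s - liftPoint y t = liftPoint (x - y) (s - t) := by
  ext i; fin_cases i <;> simp [liftPoint]

lemma liftPoint_add (x y : E2) (s t : ℝ) :
    liftPoint x s + liftPoint y t = liftPoint (x + y) (s + t) := by
  ext i; fin_cases i <;> simp [liftPoint]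

lemma liftPoint_smul (c : ℝ) (x : E2) (s : ℝ) :
    c • liftPoint x s = liftPoint (c • x) (c * s) := by
  ext i; fin_cases i <;> simp [liftPoint]

lemma norm_liftPoint_sq (x : E2) (t : ℝ) : ‖liftPoint x t‖ ^ 2 = ‖x‖ ^ 2 + t ^ 2 := by
  simp [EuclideanSpace.norm_sq_eq, Fin.sum_univ_three]

lemma norm_le_norm_liftPoint (x : E2) (t : ℝ) : ‖x‖ ≤ ‖liftPoint x t‖ := by
  have := norm_liftPoint_sq x t
  exact le_of_sq_le_sq (by nlinarith [sq_nonneg t]) (norm_nonneg _)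

lemma norm_liftPoint_le (x : E2) (t : ℝ) : ‖liftPoint x t‖ ≤ ‖x‖ + |t| := by
  have := norm_liftPoint_sq x t
  refine abs_le_of_sq_le_sq (a := ‖liftPoint x t‖) ?_ (by positivity) |> (le_abs_self _).trans
  nlinarith [sq_abs t, mul_nonneg (norm_nonneg x) (abs_nonneg t)]

lemma continuous_liftPoint : Continuous fun p : E2 × ℝ => liftPoint p.1 p.2 := by
  unfold liftPoint; fun_prop

lemma continuous_horizontal : Continuous horizontal := by
  unfold horizontal; fun_prop

/-- The parametrisation of the graph of `g`. -/
def graphMap (g : E2 → ℝ) (x : E2) : E3 := liftPoint x (g x)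

lemma continuous_graphMap {g : E2 → ℝ} (hg : Continuous g) : Continuous (graphMap g) :=
  continuous_liftPoint.comp (continuous_id.prodMk hg)

lemma range_graphMap (g : E2 → ℝ) : range (graphMap g) = {y | y 2 = g (horizontal y)} := by
  ext y
  constructor
  · rintro ⟨x, rfl⟩; simp [graphMap]
  · intro h; exact ⟨horizontal y, by rw [graphMap, ← h, liftPoint_horizontal]⟩

/-- The projection `horizontal` is a continuous left inverse, so the image of a closed set is the
closed graph cut with a closed cylinder; the map is thus a closed embedding. -/
lemma measurableEmbedding_graphMap {g : E2 → ℝ} (hg : Continuous g) :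
    MeasurableEmbedding (graphMap g) :=
  (IsClosedEmbedding.of_continuous_injective_isClosedMap (continuous_graphMap hg)
    (fun x y h => by simpa [graphMap] using congrArg horizontal h)
    (fun s hs => by
      have : graphMap g '' s = {y | y 2 = g (horizontal y)} ∩ horizontal ⁻¹' s := by
        rw [← range_graphMap]
        ext y; constructor
        · rintro ⟨x, hx, rfl⟩; exact ⟨⟨x, rfl⟩, by simpa [graphMap] using hx⟩
        · rintro ⟨⟨x, rfl⟩, hx⟩; exact ⟨x, by simpa [graphMap] using hx, rfl⟩
      rw [this]
      exact (isClosed_eq (by fun_prop) (hg.comp continuous_horizontal)).inter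
        (hs.preimage continuous_horizontal))).measurableEmbedding

/-! ### The area formula for Lipschitz graphs. -/

/-- The graph parametrisation of a linear function. -/
def linearGraphMap (a : E2 →L[ℝ] ℝ) : E2 →ₗ[ℝ] E3 where
  toFun := graphMap a
  map_add' x y := by simp [graphMap, liftPoint_add]
  map_smul' c x := by simp [graphMap, liftPoint_smul]

/-- The area factor `√(1 + |a|²)` of the graph of a linear function `a`. -/
def areaFactor (a : E2 →L[ℝ] ℝ) : ℝ :=
  √(1 + a (EuclideanSpace.single 0 1) ^ 2 + a (EuclideanSpace.single 1 1) ^ 2)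

lemma areaFactor_sq (a : E2 →L[ℝ] ℝ) : areaFactor a ^ 2 =
    1 + a (EuclideanSpace.single 0 1) ^ 2 + a (EuclideanSpace.single 1 1) ^ 2 :=
  Real.sq_sqrt (by positivity)

lemma one_le_areaFactor (a : E2 →L[ℝ] ℝ) : 1 ≤ areaFactor a :=
  Real.one_le_sqrt.2 (by rw [add_assoc]; exact le_add_of_nonneg_right (by positivity))

lemma areaFactor_pos (a : E2 →L[ℝ] ℝ) : 0 < areaFactor a :=
  zero_lt_one.trans_le (one_le_areaFactor a)

/-- With `a₀, a₁` the values of `a` on the basis, the Gram determinant is `(1 + a₀²)(1 + a₁²) -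
a₀²a₁² = 1 + a₀² + a₁²`. -/
lemma normDet_linearGraphMap (a : E2 →L[ℝ] ℝ) : (linearGraphMap a).normDet = areaFactor a := by
  have h := (linearGraphMap a).normDet_sq_eq_det_gram (EuclideanSpace.basisFun (Fin 2) ℝ)
  have h2 : (linearGraphMap a).normDet ^ 2 = areaFactor a ^ 2 := by
    rw [areaFactor_sq]
    refine (show (linearGraphMap a).normDet ^ 2 = _ from h).trans ?_
    simp [Matrix.det_fin_two, Matrix.gram, linearGraphMap, graphMap, PiLp.inner_apply,
      Fin.sum_univ_three]
    ring
  exact (sq_eq_sq₀ (LinearMap.normDet_nonneg _) (areaFactor_pos a).le).1 h2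

lemma euclideanHausdorffMeasure_linearGraphMap_image (a : E2 →L[ℝ] ℝ) (s : Set E2) :
    μHE[2] (linearGraphMap a '' s) = ENNReal.ofReal (areaFactor a) * volume s := by
  have := (linearGraphMap a).euclideanHausdorffMeasure_image_eq_normDet_mul_volume s
  rwa [finrank_euclideanSpace_fin, normDet_linearGraphMap] at this

/-- The map `f' x ↦ f x` is `c`-Lipschitz on `f' '' s`; it is well defined even if `f'` is not
injective, because the hypothesis forces `f` to agree wherever `f'` does. -/
lemma euclideanHausdorffMeasure_image_le_of_dist_le {X Y Z : Type*} [MetricSpace Y]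
    [MeasurableSpace Y] [BorelSpace Y] [MetricSpace Z] [MeasurableSpace Z] [BorelSpace Z]
    {f : X → Y} {f' : X → Z} {s : Set X} {c : ℝ≥0} (d : ℕ)
    (h : ∀ x ∈ s, ∀ y ∈ s, dist (f x) (f y) ≤ c * dist (f' x) (f' y)) :
    μHE[d] (f '' s) ≤ (c : ℝ≥0∞) ^ d * μHE[d] (f' '' s) := by
  rcases s.eq_empty_or_nonempty with rfl | ⟨x₀, hx₀⟩
  · simp
  have : Nonempty X := ⟨x₀⟩
  have hmem : ∀ z ∈ f' '' s, Function.invFunOn f' s z ∈ s ∧ f' (Function.invFunOn f' s z) = z :=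
    fun z hz => Function.invFunOn_pos hz
  have hL : LipschitzOnWith c (f ∘ Function.invFunOn f' s) (f' '' s) := by
    refine LipschitzOnWith.of_dist_le_mul fun z hz w hw => ?_
    have := h _ (hmem z hz).1 _ (hmem w hw).1
    rwa [(hmem z hz).2, (hmem w hw).2] at this
  have himg : f '' s = (f ∘ Function.invFunOn f' s) '' (f' '' s) := by
    rw [image_image]
    refine image_congr fun x hx => ?_
    have hm := hmem _ (mem_image_of_mem f' hx)
    have := h x hx _ hm.1
    rw [hm.2, dist_self, mul_zero] at this
    exact dist_le_zero.1 this
  rw [himg, Measure.euclideanHausdorffMeasure_def, Measure.euclideanHausdorffMeasure_def]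
  simp only [Measure.smul_apply, ENNReal.smul_def, smul_eq_mul]
  have := hL.hausdorffMeasure_image_le (d := d) (by positivity)
  rw [ENNReal.rpow_natCast] at this
  calc _ ≤ _ := mul_le_mul_right this _
    _ = _ := by ring

lemma dist_graphMap_sub_le {g : E2 → ℝ} {a : E2 →L[ℝ] ℝ} {s : Set E2} {δ : ℝ≥0}
    (h : ApproximatesLinearOn g a s δ) {x y : E2} (hx : x ∈ s) (hy : y ∈ s) :
    ‖(graphMap g x - graphMap g y) - (linearGraphMap a x - linearGraphMap a y)‖ ≤
      δ * ‖x - y‖ := by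
  have e : (graphMap g x - graphMap g y) - (linearGraphMap a x - linearGraphMap a y)
      = liftPoint 0 (g x - g y - a (x - y)) := by
    change (liftPoint x (g x) - liftPoint y (g y)) - (liftPoint x (a x) - liftPoint y (a y)) = _
    simp [liftPoint_sub]
  rw [e]
  refine (norm_liftPoint_le _ _).trans ?_
  simpa using h x hx y hy

lemma norm_sub_le_norm_graphMap_sub (g : E2 → ℝ) (x y : E2) :
    ‖x - y‖ ≤ ‖graphMap g x - graphMap g y‖ := by
  rw [graphMap, graphMap, liftPoint_sub]; exact norm_le_norm_liftPoint _ _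

/-- Projecting a graph to the plane does not increase distances, so the additive error `δ‖x - y‖` is
a relative error: passing from the linear graph to the graph of `g` stretches lengths by at most `1
+ δ`, hence areas by its square. In `le_graphMap_image` the roles are exchanged. -/
lemma graphMap_image_le {g : E2 → ℝ} {a : E2 →L[ℝ] ℝ} {s : Set E2} {δ : ℝ≥0}
    (h : ApproximatesLinearOn g a s δ) :
    μHE[2] (graphMap g '' s) ≤
      ((1 + δ : ℝ≥0) : ℝ≥0∞) ^ 2 * (ENNReal.ofReal (areaFactor a) * volume s) := by
  rw [← euclideanHausdorffMeasure_linearGraphMap_image]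
  refine euclideanHausdorffMeasure_image_le_of_dist_le 2 fun x hx y hy => ?_
  have h1 := dist_graphMap_sub_le h hx hy
  have h2 : ‖x - y‖ ≤ ‖linearGraphMap a x - linearGraphMap a y‖ :=
    norm_sub_le_norm_graphMap_sub a x y
  have h3 := norm_sub_norm_le (graphMap g x - graphMap g y)
    (linearGraphMap a x - linearGraphMap a y)
  rw [dist_eq_norm, dist_eq_norm]
  push_cast
  nlinarith [mul_le_mul_of_nonneg_left h2 δ.2]

lemma le_graphMap_image {g : E2 → ℝ} {a : E2 →L[ℝ] ℝ} {s : Set E2} {δ : ℝ≥0}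
    (h : ApproximatesLinearOn g a s δ) :
    ENNReal.ofReal (areaFactor a) * volume s ≤
      ((1 + δ : ℝ≥0) : ℝ≥0∞) ^ 2 * μHE[2] (graphMap g '' s) := by
  rw [← euclideanHausdorffMeasure_linearGraphMap_image]
  refine euclideanHausdorffMeasure_image_le_of_dist_le 2 fun x hx y hy => ?_
  have h1 := dist_graphMap_sub_le h hx hy
  have h2 := norm_sub_le_norm_graphMap_sub g x y
  have h3 := norm_sub_norm_le (linearGraphMap a x - linearGraphMap a y)
    (graphMap g x - graphMap g y)
  rw [norm_sub_rev] at h1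
  rw [dist_eq_norm, dist_eq_norm]
  push_cast
  nlinarith [mul_le_mul_of_nonneg_left h2 δ.2]

lemma measure_le_of_forall_inter_le {α ι : Type*} [MeasurableSpace α] [Countable ι]
    {m ν : Measure α} {s : Set α} (hs : MeasurableSet s) {t : ι → Set α}
    (ht : ∀ i, MeasurableSet (t i)) (hd : Pairwise (Function.onFun Disjoint t))
    (hst : s ⊆ ⋃ i, t i) (h : ∀ i, m (s ∩ t i) ≤ ν (s ∩ t i)) : m s ≤ ν s := by
  have e : s = ⋃ i, s ∩ t i := by rw [← inter_iUnion, inter_eq_left.2 hst]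
  calc m s = m (⋃ i, s ∩ t i) := by rw [← e]
    _ ≤ ∑' i, ν (s ∩ t i) := (measure_iUnion_le _).trans (ENNReal.tsum_le_tsum h)
    _ = ν s := by
      rw [← measure_iUnion (fun i j hij => (hd hij).mono inter_subset_right inter_subset_right)
        (fun i => hs.inter (ht i)), ← e]

/-- The area density of the graph of `g`. -/
def graphDensity (g : E2 → ℝ) (x : E2) : ℝ := areaFactor (fderiv ℝ g x)

lemma measurable_graphDensity (g : E2 → ℝ) : Measurable (graphDensity g) := by
  unfold graphDensity areaFactor
  have := measurable_fderiv_apply_const ℝ g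
  fun_prop

/-- The surface measure of the graph of `g`, as a measure on the horizontal plane. -/
def graphMeasure (g : E2 → ℝ) : Measure E2 := (μHE[2] : Measure E3).comap (graphMap g)

lemma graphMeasure_apply {g : E2 → ℝ} (hg : Continuous g) (s : Set E2) :
    graphMeasure g s = μHE[2] (graphMap g '' s) :=
  (measurableEmbedding_graphMap hg).comap_apply _ _

/-- A Lipschitz parametrisation sends null sets to null sets. This allows the points where `g` is
not differentiable to be discarded. -/
lemma graphMeasure_absolutelyContinuous {g : E2 → ℝ} {K : ℝ≥0} (hg : LipschitzWith K g) :
    graphMeasure g ≪ volume := by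
  intro s hs
  rw [graphMeasure_apply hg.continuous]
  have := euclideanHausdorffMeasure_image_le_of_dist_le (f := graphMap g) (f' := (id : E2 → E2))
    (s := s) (c := 1 + K) 2 (fun x _ y _ => by
      rw [dist_eq_norm, dist_eq_norm, graphMap, graphMap, liftPoint_sub]
      refine (norm_liftPoint_le _ _).trans ?_
      have := hg.dist_le_mul x y
      rw [Real.dist_eq, dist_eq_norm] at this
      push_cast; simp only [id]; linarith)
  rw [image_id, EuclideanSpace.euclideanHausdorffMeasure_eq_volume, hs, mul_zero] at this
  exact le_antisymm this (zero_le)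

section pieces

variable {g : E2 → ℝ} {θ : ℝ} {s : Set E2}

lemma setLIntegral_graphDensity_bounds {k : ℕ} (hs : MeasurableSet s)
    (hJ : ∀ x ∈ s, θ ^ k ≤ graphDensity g x ∧ graphDensity g x < θ ^ (k + 1)) :
    ENNReal.ofReal (θ ^ k) * volume s ≤ ∫⁻ x in s, ENNReal.ofReal (graphDensity g x) ∧
    ∫⁻ x in s, ENNReal.ofReal (graphDensity g x) ≤ ENNReal.ofReal (θ ^ (k + 1)) * volume s := by
  rw [← setLIntegral_const, ← setLIntegral_const]
  exact ⟨setLIntegral_mono' hs fun x hx => ENNReal.ofReal_le_ofReal (hJ x hx).1,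
    setLIntegral_mono' hs fun x hx => ENNReal.ofReal_le_ofReal (hJ x hx).2.le⟩

/-- Of the three factors `θ`, one pays for the variation of the density within a level and two for
replacing `g` by linear functions on small pieces. -/
lemma graphMeasure_bounds_of_level (hg : Continuous g) (hθ : 1 < θ) {k : ℕ}
    (hs : MeasurableSet s) (hd : ∀ x ∈ s, DifferentiableAt ℝ g x)
    (hJ : ∀ x ∈ s, θ ^ k ≤ graphDensity g x ∧ graphDensity g x < θ ^ (k + 1)) :
    graphMeasure g s ≤ (ENNReal.ofReal (θ ^ 3) • volume.withDensity
      fun x => ENNReal.ofReal (graphDensity g x)) s ∧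
    (volume.withDensity fun x => ENNReal.ofReal (graphDensity g x)) s ≤
      (ENNReal.ofReal (θ ^ 3) • graphMeasure g) s := by
  rcases s.eq_empty_or_nonempty with rfl | hne
  · simp
  have hθ0 : 0 < θ := zero_lt_one.trans hθ
  -- Chosen so that the distortion `1 + δ` equals `θ`.
  let δ : ℝ≥0 := ⟨θ - 1, by linarith⟩
  have hδ : ((1 + δ : ℝ≥0) : ℝ≥0∞) = ENNReal.ofReal θ := by
    rw [ENNReal.ofReal]; congr 1
    ext; push_cast; rw [Real.coe_toNNReal _ hθ0.le]
    change 1 + (θ - 1) = θ; ring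
  have hδ0 : δ ≠ 0 := by
    intro h; have : θ - 1 = 0 := congrArg NNReal.toReal h; linarith
  obtain ⟨t, A, htd, htm, hst, hA, hAs⟩ := exists_partition_approximatesLinearOn_of_hasFDerivWithinAt
    g s (fderiv ℝ g) (fun x hx => (hd x hx).hasFDerivAt.hasFDerivWithinAt) (fun _ => δ)
    (fun _ => hδ0)
  -- Each approximating linear map is the derivative of `g` at some point of `s`, so its area factor
  -- lies in the same level.
  have hAJ : ∀ n, θ ^ k ≤ areaFactor (A n) ∧ areaFactor (A n) < θ ^ (k + 1) := fun n => by
    obtain ⟨y, hy, e⟩ := hAs hne n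
    rw [e]; exact hJ y hy
  constructor
  · refine measure_le_of_forall_inter_le hs htm htd hst fun n => ?_
    rw [graphMeasure_apply hg, Measure.smul_apply, withDensity_apply _ (hs.inter (htm n)),
      smul_eq_mul]
    refine (graphMap_image_le (hA n)).trans ?_
    rw [hδ]
    calc _ ≤ ENNReal.ofReal θ ^ 2 * (ENNReal.ofReal (θ ^ (k + 1)) * volume (s ∩ t n)) := by
          gcongr; exact (hAJ n).2.le
      _ = ENNReal.ofReal (θ ^ 3) * (ENNReal.ofReal (θ ^ k) * volume (s ∩ t n)) := by
          rw [← ENNReal.ofReal_pow hθ0.le, ← mul_assoc, ← mul_assoc,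
            ← ENNReal.ofReal_mul (by positivity), ← ENNReal.ofReal_mul (by positivity)]
          congr 2; ring
      _ ≤ _ := by
          gcongr
          exact (setLIntegral_graphDensity_bounds (hs.inter (htm n)) fun x hx => hJ x hx.1).1
  · refine measure_le_of_forall_inter_le hs htm htd hst fun n => ?_
    rw [Measure.smul_apply, graphMeasure_apply hg, withDensity_apply _ (hs.inter (htm n)),
      smul_eq_mul]
    refine (setLIntegral_graphDensity_bounds (hs.inter (htm n)) fun x hx => hJ x hx.1).2.trans ?_
    calc _ ≤ ENNReal.ofReal θ * (ENNReal.ofReal (areaFactor (A n)) * volume (s ∩ t n)) := by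
          rw [← mul_assoc, ← ENNReal.ofReal_mul hθ0.le]
          gcongr
          rw [pow_succ, mul_comm]
          exact mul_le_mul_of_nonneg_left (hAJ n).1 hθ0.le
      _ ≤ ENNReal.ofReal θ * (ENNReal.ofReal θ ^ 2 * μHE[2] (graphMap g '' (s ∩ t n))) := by
          refine mul_le_mul_right ?_ _
          rw [← hδ]; exact le_graphMap_image (hA n)
      _ = _ := by
          rw [← mul_assoc, ← ENNReal.ofReal_pow hθ0.le, ← ENNReal.ofReal_mul hθ0.le]
          congr 2; ring

/-- The levels `[θ^k, θ^(k+1))` with natural `k` already cover everything, because the density is at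
least `1`. -/
lemma graphMeasure_bounds (hg : Continuous g) (hθ : 1 < θ)
    (hs : MeasurableSet s) (hd : ∀ x ∈ s, DifferentiableAt ℝ g x) :
    graphMeasure g s ≤ (ENNReal.ofReal (θ ^ 3) • volume.withDensity
      fun x => ENNReal.ofReal (graphDensity g x)) s ∧
    (volume.withDensity fun x => ENNReal.ofReal (graphDensity g x)) s ≤
      (ENNReal.ofReal (θ ^ 3) • graphMeasure g) s := by
  let L : ℕ → Set E2 := fun k => graphDensity g ⁻¹' Ico (θ ^ k) (θ ^ (k + 1))
  have hLm : ∀ k, MeasurableSet (L k) := fun k => measurable_graphDensity g measurableSet_Ico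
  have hLd : Pairwise (Function.onFun Disjoint L) := fun i j hij =>
    Disjoint.preimage _ ((pow_right_mono₀ hθ.le).pairwise_disjoint_on_Ico_succ hij)
  have hsL : s ⊆ ⋃ k, L k := fun x _ => by
    obtain ⟨n, h1, h2⟩ := exists_nat_pow_near (one_le_areaFactor (fderiv ℝ g x)) hθ
    exact mem_iUnion.2 ⟨n, h1, h2⟩
  have key := fun k => graphMeasure_bounds_of_level hg hθ (hs.inter (hLm k))
    (fun x hx => hd x hx.1) (k := k) (fun x hx => hx.2)
  exact ⟨measure_le_of_forall_inter_le hs hLm hLd hsL fun k => (key k).1,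
    measure_le_of_forall_inter_le hs hLm hLd hsL fun k => (key k).2⟩

end pieces

lemma ENNReal.le_of_forall_one_lt_cube_mul_le {a b : ℝ≥0∞}
    (h : ∀ θ : ℝ, 1 < θ → a ≤ ENNReal.ofReal (θ ^ 3) * b) : a ≤ b := by
  have h1 : Tendsto (fun θ : ℝ => ENNReal.ofReal (θ ^ 3) * b) (𝓝[>] 1) (𝓝 (1 * b)) := by
    refine ENNReal.Tendsto.mul_const ?_ (Or.inl one_ne_zero)
    rw [← ENNReal.ofReal_one]
    refine ENNReal.tendsto_ofReal (tendsto_nhdsWithin_of_tendsto_nhds ?_)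
    have : Continuous fun θ : ℝ => θ ^ 3 := by fun_prop
    simpa using this.tendsto 1
  rw [one_mul] at h1
  exact ge_of_tendsto h1 (eventually_mem_nhdsWithin.mono fun θ hθ => h θ hθ)

theorem graphMeasure_eq_withDensity {g : E2 → ℝ} {K : ℝ≥0} (hg : LipschitzWith K g) :
    graphMeasure g = volume.withDensity fun x => ENNReal.ofReal (graphDensity g x) := by
  set D : Set E2 := {x | DifferentiableAt ℝ g x}
  have hDm : MeasurableSet D := measurableSet_of_differentiableAt ℝ g
  have hD : volume Dᶜ = 0 := hg.ae_differentiableAt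
  ext s hs
  -- By Rademacher's theorem, an absolutely continuous measure sees only the points of
  -- differentiability.
  have e : ∀ m : Measure E2, m ≪ volume → m s = m (s ∩ D) := fun m hm => by
    refine le_antisymm ?_ (measure_mono inter_subset_left)
    rw [← measure_inter_add_sdiff s hDm]
    simp [measure_mono_null (sdiff_subset_compl s D) (hm hD)]
  rw [e _ (graphMeasure_absolutelyContinuous hg), e _ (withDensity_absolutelyContinuous _ _)]
  have key := fun θ (hθ : 1 < θ) => graphMeasure_bounds hg.continuous hθ (hs.inter hDm)
    (fun x hx => hx.2)
  exact le_antisymm (ENNReal.le_of_forall_one_lt_cube_mul_le fun θ hθ => (key θ hθ).1)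
    (ENNReal.le_of_forall_one_lt_cube_mul_le fun θ hθ => (key θ hθ).2)

/-- The area formula for a Lipschitz graph. -/
theorem euclideanHausdorffMeasure_restrict_graph {g : E2 → ℝ} {K : ℝ≥0} (hg : LipschitzWith K g) :
    (μHE[2] : Measure E3).restrict (range (graphMap g)) =
      (volume.withDensity fun x => ENNReal.ofReal (graphDensity g x)).map (graphMap g) := by
  rw [← graphMeasure_eq_withDensity hg, graphMeasure,
    (measurableEmbedding_graphMap hg.continuous).map_comap]

/-! ### The divergence theorem below a Lipschitz graph. -/

/-- `liftPoint` as a continuous linear map. -/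
def liftCLM : E2 × ℝ →L[ℝ] E3 :=
  LinearMap.toContinuousLinearMap
    { toFun := fun p => liftPoint p.1 p.2
      map_add' := fun p q => by simp [liftPoint_add]
      map_smul' := fun c p => by simp [liftPoint_smul] }

@[simp] lemma liftCLM_apply (p : E2 × ℝ) : liftCLM p = liftPoint p.1 p.2 := rfl

lemma measurePreserving_liftPoint :
    MeasurePreserving (fun p : E2 × ℝ => liftPoint p.1 p.2) (volume.prod volume) volume := by
  have h1 : MeasurePreserving (Prod.map (WithLp.ofLp : E2 → (Fin 2 → ℝ)) (id : ℝ → ℝ))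
      (volume.prod volume) (volume.prod volume) :=
    (PiLp.volume_preserving_ofLp (Fin 2)).prod (MeasurePreserving.id volume)
  have h2 : MeasurePreserving (Prod.swap : (Fin 2 → ℝ) × ℝ → ℝ × (Fin 2 → ℝ))
      (volume.prod volume) (volume.prod volume) := Measure.measurePreserving_swap
  have h3 := (volume_preserving_piFinSuccAbove (fun _ : Fin 3 => ℝ) 2).symm
  have h4 := PiLp.volume_preserving_toLp (Fin 3)
  have e : (fun p : E2 × ℝ => liftPoint p.1 p.2) = WithLp.toLp 2 ∘
      (((MeasurableEquiv.piFinSuccAbove (fun _ : Fin 3 => ℝ) 2).symm ∘ Prod.swap) ∘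
        Prod.map (WithLp.ofLp : E2 → (Fin 2 → ℝ)) (id : ℝ → ℝ)) := by
    funext p
    ext i
    fin_cases i <;> rfl
  rw [e]
  exact h4.comp ((h3.comp h2).comp h1)

/-- The open region below the graph of `g`. -/
def subgraph (g : E2 → ℝ) : Set E3 := {y | y 2 < g (horizontal y)}

lemma isOpen_subgraph {g : E2 → ℝ} (hg : Continuous g) : IsOpen (subgraph g) :=
  isOpen_lt (by fun_prop) (hg.comp continuous_horizontal)

/-- Coordinates adapted to the graph of `g`: the point at depth `p.2` below the graph. -/
def shear (g : E2 → ℝ) (p : E2 × ℝ) : E3 := liftPoint p.1 (g p.1 - p.2)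

/-- On each vertical line the map is a reflection followed by a translation, so Fubini suffices and
no differentiability of `g` is involved. -/
lemma measurePreserving_shear {g : E2 → ℝ} (hg : Continuous g) :
    MeasurePreserving (shear g) (volume.prod volume) volume := by
  have h : MeasurePreserving (fun p : E2 × ℝ => (p.1, g p.1 - p.2))
      (volume.prod volume) (volume.prod volume) :=
    MeasurePreserving.skew_product (f := id) (g := fun x s => g x - s) (MeasurePreserving.id _)
      (by fun_prop) (ae_of_all _ fun x => (Measure.measurePreserving_sub_left volume (g x)).map_eq)
  exact measurePreserving_liftPoint.comp h

lemma measurableEmbedding_shear {g : E2 → ℝ} (hg : Continuous g) :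
    MeasurableEmbedding (shear g) := by
  let e : E2 × ℝ ≃ₜ E3 :=
    { toFun := shear g
      invFun := fun y => (horizontal y, g (horizontal y) - y 2)
      left_inv := fun p => by simp [shear]
      right_inv := fun y => by simp [shear]
      continuous_toFun := continuous_liftPoint.comp
        (continuous_fst.prodMk ((hg.comp continuous_fst).sub continuous_snd))
      continuous_invFun := continuous_horizontal.prodMk
        ((hg.comp continuous_horizontal).sub (by fun_prop)) }
  exact e.measurableEmbedding

lemma shear_preimage_subgraph (g : E2 → ℝ) : shear g ⁻¹' subgraph g = univ ×ˢ Ioi 0 := by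
  ext p; simp [shear, subgraph]

lemma integrable_comp_shear {g : E2 → ℝ} (hg : Continuous g) {h : E3 → ℝ}
    (hh : IntegrableOn h (subgraph g)) :
    Integrable (fun p => h (shear g p)) (volume.prod (volume.restrict (Ioi 0))) := by
  have := ((measurePreserving_shear hg).integrableOn_comp_preimage
    (measurableEmbedding_shear hg)).2 hh
  rwa [shear_preimage_subgraph, IntegrableOn, ← Measure.prod_restrict, Measure.restrict_univ]
    at this

lemma setIntegral_subgraph {g : E2 → ℝ} (hg : Continuous g) (h : E3 → ℝ) :
    ∫ y in subgraph g, h y = ∫ p, h (shear g p) ∂(volume.prod (volume.restrict (Ioi 0))) := by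
  rw [← (measurePreserving_shear hg).setIntegral_preimage_emb (measurableEmbedding_shear hg),
    shear_preimage_subgraph, ← Measure.prod_restrict, Measure.restrict_univ]

lemma hasFDerivAt_graphMap {g : E2 → ℝ} {x : E2} (hg : DifferentiableAt ℝ g x) :
    HasFDerivAt (graphMap g)
      (liftCLM.comp ((ContinuousLinearMap.id ℝ E2).prod (fderiv ℝ g x))) x :=
  liftCLM.hasFDerivAt.comp x ((hasFDerivAt_id x).prodMk hg.hasFDerivAt)

lemma lipschitzWith_graphMap {g : E2 → ℝ} {K : ℝ≥0} (hg : LipschitzWith K g) :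
    LipschitzWith (1 + K) (graphMap g) := by
  refine LipschitzWith.of_dist_le_mul fun x y => ?_
  rw [dist_eq_norm, dist_eq_norm, graphMap, graphMap, liftPoint_sub]
  refine (norm_liftPoint_le _ _).trans ?_
  have := hg.dist_le_mul x y
  rw [Real.dist_eq, dist_eq_norm] at this
  push_cast; linarith

lemma hasCompactSupport_comp_graphMap {F : Type*} [Zero F] {φ : E3 → F} (hc : HasCompactSupport φ)
    (g : E2 → ℝ) : HasCompactSupport fun x => φ (graphMap g x) :=
  HasCompactSupport.intro (hc.image continuous_horizontal) fun x hx =>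
    image_eq_zero_of_notMem_tsupport fun h => hx ⟨_, h, by simp [graphMap]⟩

/-- The tangential derivative of a compactly supported function along a Lipschitz graph has
integral zero. -/
lemma integral_fderiv_graphMap_eq_zero {g : E2 → ℝ} {K : ℝ≥0} (hg : LipschitzWith K g)
    {φ : E3 → ℝ} (hφ : ContDiff ℝ 1 φ) (hc : HasCompactSupport φ) (v : E2) :
    ∫ x, fderiv ℝ φ (graphMap g x) (liftPoint v (fderiv ℝ g x v)) = 0 := by
  obtain ⟨C, hC⟩ := ContDiff.lipschitzWith_of_hasCompactSupport hc hφ one_ne_zero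
  -- Integration by parts of the Lipschitz function `φ ∘ graphMap g` against the constant `1`. The
  -- formula reverses the direction, hence `-v`.
  have h := LipschitzWith.integral_lineDeriv_mul_eq (μ := (volume : Measure E2))
    (LipschitzWith.const (1 : ℝ)) (hC.comp (lipschitzWith_graphMap hg))
    (hasCompactSupport_comp_graphMap hc g) (-v)
  have h0 : ∀ x : E2, lineDeriv ℝ (fun _ : E2 => (1 : ℝ)) x (-v) = 0 := fun x => by
    rw [DifferentiableAt.lineDeriv_eq_fderiv (by fun_prop)]; simp
  simp only [h0, zero_mul, integral_zero, neg_neg, mul_one] at h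
  rw [h]
  refine integral_congr_ae ?_
  filter_upwards [hg.ae_differentiableAt] with x hx
  have h1 := ((hφ.differentiable one_ne_zero _).hasFDerivAt.comp x
    (hasFDerivAt_graphMap hx)).hasLineDerivAt v
  rw [h1.lineDeriv]
  simp

/-- The fundamental theorem of calculus on the half-line hanging from the graph; depth increases
downwards, which accounts for the sign of the boundary value. -/
lemma integral_Ioi_fderiv_shear {g : E2 → ℝ}
    {φ : E3 → ℝ} (hφ : ContDiff ℝ 1 φ) (hc : HasCompactSupport φ) (x : E2) :
    ∫ s in Ioi (0 : ℝ), fderiv ℝ φ (shear g (x, s)) (liftPoint 0 1) = φ (graphMap g x) := by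
  let f : ℝ → ℝ := fun s => φ (liftCLM (x, g x - s))
  have hf : ContDiff ℝ 1 f := hφ.comp (liftCLM.contDiff.comp (by fun_prop))
  have hfc : HasCompactSupport f := by
    refine HasCompactSupport.intro (K := (fun y : E3 => g x - y 2) '' tsupport φ)
      (hc.image (by fun_prop)) fun s hs => ?_
    exact image_eq_zero_of_notMem_tsupport (f := φ) fun h => hs ⟨_, h, by simp⟩
  have h := hfc.integral_Ioi_deriv_eq hf 0
  have hd : ∀ s, deriv f s = - fderiv ℝ φ (shear g (x, s)) (liftPoint 0 1) := fun s => by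
    have h1 : HasDerivAt (fun s : ℝ => (x, g x - s)) ((0 : E2), (-1 : ℝ)) s :=
      (hasDerivAt_const s x).prodMk (by simpa using (hasDerivAt_id s).const_sub (g x))
    have h2 := (hφ.differentiable one_ne_zero
      (liftCLM (x, g x - s))).hasFDerivAt.comp_hasDerivAt s
        (liftCLM.hasFDerivAt.comp_hasDerivAt s h1)
    have h3 : liftPoint (0 : E2) (-1) = -liftPoint 0 1 := by
      ext i; fin_cases i <;> simp [liftPoint]
    refine h2.deriv.trans ?_
    simp [shear, h3]
  simp only [hd, integral_neg] at h
  have h5 : f 0 = φ (graphMap g x) := by simp [f, graphMap]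
  rw [← h5]; linarith

/-- The divergence theorem below a Lipschitz graph, for one component of a smooth field. -/
theorem integral_subgraph_fderiv {g : E2 → ℝ} {K : ℝ≥0} (hg : LipschitzWith K g)
    {φ : E3 → ℝ} (hφ : ContDiff ℝ 1 φ) (hc : HasCompactSupport φ) (v : E2) (c : ℝ) :
    ∫ y in subgraph g, fderiv ℝ φ y (liftPoint v c) =
      ∫ x, φ (graphMap g x) * (c - fderiv ℝ g x v) := by
  have hint : ∀ w : E3, Integrable fun y => fderiv ℝ φ y w := fun w =>
    ((hφ.continuous_fderiv one_ne_zero).clm_apply continuous_const).integrable_of_hasCompactSupport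
      (hc.fderiv_apply ℝ w)
  have hS := fun w => integrable_comp_shear hg.continuous (hint w).integrableOn
  let J : E2 × ℝ → ℝ := fun p => fderiv ℝ φ (shear g p) (liftPoint 0 1)
  have hJ : Integrable J (volume.prod (volume.restrict (Ioi 0))) := hS _
  have hbd' : ∀ x, ‖c - fderiv ℝ g x v‖ ≤ |c| + K * ‖v‖ := fun x => by
    refine (norm_sub_le _ _).trans (add_le_add le_rfl ?_)
    exact (ContinuousLinearMap.le_opNorm _ _).trans
      (mul_le_mul_of_nonneg_right (norm_fderiv_le_of_lipschitz ℝ hg) (norm_nonneg _))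
  have hm : Measurable fun p : E2 × ℝ => c - fderiv ℝ g p.1 v :=
    measurable_const.sub ((measurable_fderiv_apply_const ℝ g v).comp measurable_fst)
  have hJ2 : Integrable (fun p => (c - fderiv ℝ g p.1 v) * J p)
      (volume.prod (volume.restrict (Ioi 0))) := hJ.bdd_mul hm.aestronglyMeasurable
    (ae_of_all _ fun p => hbd' p.1)
  rw [setIntegral_subgraph hg.continuous, integral_prod_symm _ (hS _)]
  -- On the slice at depth `s`, which is a translate of the graph, `(v, c)` is split as the tangent
  -- vector `(v, Dg v)` plus `c - Dg v` times the vertical unit vector. The tangential part has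
  -- integral zero by `hz`.
  have key : ∀ s : ℝ, ∫ x, fderiv ℝ φ (shear g (x, s)) (liftPoint v c) =
      (∫ x, fderiv ℝ φ (shear g (x, s)) (liftPoint v (fderiv ℝ g x v))) +
      ∫ x, (c - fderiv ℝ g x v) * J (x, s) := fun s => by
    have hi : ∀ w, Integrable fun x : E2 => fderiv ℝ φ (shear g (x, s)) w := fun w => by
      refine Continuous.integrable_of_hasCompactSupport
        (((hφ.continuous_fderiv one_ne_zero).comp (continuous_graphMap
          (g := fun x => g x - s) (by have := hg.continuous; fun_prop))).clm_apply
            continuous_const) ?_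
      exact hasCompactSupport_comp_graphMap (hc.fderiv_apply ℝ w) (fun x => g x - s)
    have hi2 : Integrable fun x => (c - fderiv ℝ g x v) * J (x, s) :=
      (hi (liftPoint 0 1)).bdd_mul (c := |c| + K * ‖v‖)
        (measurable_const.sub (measurable_fderiv_apply_const ℝ g v)).aestronglyMeasurable
        (ae_of_all _ fun x => hbd' x)
    rw [← sub_eq_iff_eq_add, ← integral_sub (hi _) hi2]
    congr 1
    funext x
    have : liftPoint v c = liftPoint v (fderiv ℝ g x v) +
        (c - fderiv ℝ g x v) • liftPoint 0 1 := by
      simp [liftPoint_smul, liftPoint_add]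
    rw [this, map_add, map_smul]
    simp [J]
  have hz : ∀ s : ℝ, ∫ x, fderiv ℝ φ (shear g (x, s)) (liftPoint v (fderiv ℝ g x v)) = 0 :=
    fun s => by
      have hgs : LipschitzWith K fun x => g x - s := by
        simpa using hg.sub (LipschitzWith.const s)
      have := integral_fderiv_graphMap_eq_zero hgs hφ hc v
      simp only [fderiv_sub_const] at this
      exact this
  simp only [key, hz, zero_add]
  -- The weight `c - Dg v` does not depend on the depth, so integrating first along vertical lines
  -- leaves only the value of `φ` on the graph.
  rw [← integral_prod_symm _ hJ2, integral_prod _ hJ2]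
  refine integral_congr_ae (ae_of_all _ fun x => ?_)
  simp only [J]
  rw [integral_const_mul, integral_Ioi_fderiv_shear hφ hc, mul_comm]

/-- The divergence of a vector field. -/
def divergence (W : E3 → E3) (y : E3) : ℝ := LinearMap.trace ℝ E3 (fderiv ℝ W y : E3 →ₗ[ℝ] E3)

lemma divergence_eq_sum (W : E3 → E3) (y : E3) :
    divergence W y = ∑ i, fderiv ℝ W y (EuclideanSpace.single i 1) i := by
  rw [divergence, LinearMap.trace_eq_sum_inner _ (EuclideanSpace.basisFun (Fin 3) ℝ)]
  simp [EuclideanSpace.inner_single_left]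

lemma divergence_congr {V W : E3 → E3} {y : E3} (h : V =ᶠ[𝓝 y] W) :
    divergence V y = divergence W y := by
  rw [divergence, divergence, h.fderiv_eq]

/-- The upward normal `(-∇g, 1)` of the graph of `g`. -/
def graphNormal (g : E2 → ℝ) (x : E2) : E3 :=
  !₂[-fderiv ℝ g x (EuclideanSpace.single 0 1), -fderiv ℝ g x (EuclideanSpace.single 1 1), 1]

lemma norm_graphNormal (g : E2 → ℝ) (x : E2) : ‖graphNormal g x‖ = graphDensity g x := by
  rw [EuclideanSpace.norm_eq, graphDensity, areaFactor]
  congr 1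
  simp [graphNormal, Fin.sum_univ_three]
  ring

lemma measurable_graphNormal (g : E2 → ℝ) : Measurable (graphNormal g) := by
  have := measurable_fderiv_apply_const ℝ g
  refine (WithLp.measurable_toLp 2 _).comp (measurable_pi_lambda _ fun i => ?_)
  fin_cases i
  · exact (this _).neg
  · exact (this _).neg
  · exact measurable_const

lemma graphDensity_le {g : E2 → ℝ} {K : ℝ≥0} (hg : LipschitzWith K g) (x : E2) :
    graphDensity g x ≤ 1 + 2 * K := by
  have h : ∀ i : Fin 2, |fderiv ℝ g x (EuclideanSpace.single i 1)| ≤ K := fun i => by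
    have := (fderiv ℝ g x).le_of_opNorm_le (norm_fderiv_le_of_lipschitz ℝ hg)
      (EuclideanSpace.single i 1)
    simpa using this
  have h2 : ∀ i : Fin 2, fderiv ℝ g x (EuclideanSpace.single i 1) ^ 2 ≤ K ^ 2 := fun i =>
    sq_le_sq' (abs_le.1 (h i)).1 (abs_le.1 (h i)).2
  rw [graphDensity, areaFactor]
  refine Real.sqrt_le_iff.2 ⟨by positivity, ?_⟩
  nlinarith [h2 0, h2 1, NNReal.coe_nonneg K, mul_nonneg (NNReal.coe_nonneg K) (NNReal.coe_nonneg K)]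

lemma single_two_eq_liftPoint (i : Fin 2) :
    (EuclideanSpace.single i.castSucc (1 : ℝ) : E3) =
      liftPoint (EuclideanSpace.single i 1) 0 := by
  ext j; fin_cases i <;> fin_cases j <;> simp [liftPoint]

lemma single_eq_liftPoint_zero_one :
    (EuclideanSpace.single (2 : Fin 3) (1 : ℝ) : E3) = liftPoint 0 1 := by
  ext j; fin_cases j <;> simp [liftPoint]

lemma fderiv_coord {W : E3 → E3} {y : E3} (h : DifferentiableAt ℝ W y) (v : E3) (i : Fin 3) :
    fderiv ℝ W y v i = fderiv ℝ (fun z => W z i) y v := by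
  have := ((EuclideanSpace.proj i : E3 →L[ℝ] ℝ).hasFDerivAt.comp y h.hasFDerivAt).fderiv
  exact (congrArg (fun L : E3 →L[ℝ] ℝ => L v) this).symm

/-- The divergence theorem below a Lipschitz graph, for smooth fields. -/
theorem integral_subgraph_divergence_of_contDiff {g : E2 → ℝ} {K : ℝ≥0} (hg : LipschitzWith K g)
    {W : E3 → E3} (hW : ContDiff ℝ 1 W) (hc : HasCompactSupport W) :
    ∫ y in subgraph g, divergence W y =
      ∫ x, inner ℝ (W (graphMap g x)) (graphNormal g x) := by
  have hWi : ∀ i, ContDiff ℝ 1 fun y => W y i := fun i => by fun_prop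
  have hci : ∀ i, HasCompactSupport fun y => W y i := fun i =>
    hc.comp_left (g := fun z : E3 => z i) rfl
  have hint : ∀ i, ∀ w, Integrable fun y => fderiv ℝ (fun z => W z i) y w := fun i w =>
    (((hWi i).continuous_fderiv one_ne_zero).clm_apply
      continuous_const).integrable_of_hasCompactSupport ((hci i).fderiv_apply ℝ w)
  have hint2 : ∀ i, ∀ c : ℝ, ∀ v : E2,
      Integrable fun x => W (graphMap g x) i * (c - fderiv ℝ g x v) := fun i c v => by
    have h1 : Integrable fun x => W (graphMap g x) i :=
      ((hWi i).continuous.comp (continuous_graphMap hg.continuous)).integrable_of_hasCompactSupport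
        (hasCompactSupport_comp_graphMap (hci i) g)
    refine h1.mul_bdd (c := |c| + K * ‖v‖)
      (measurable_const.sub (measurable_fderiv_apply_const ℝ g v)).aestronglyMeasurable
      (ae_of_all _ fun x => (norm_sub_le _ _).trans (add_le_add le_rfl ?_))
    exact (fderiv ℝ g x).le_of_opNorm_le (norm_fderiv_le_of_lipschitz ℝ hg) v
  have e1 : ∀ y, divergence W y =
      fderiv ℝ (fun z => W z 0) y (liftPoint (EuclideanSpace.single 0 1) 0) +
      fderiv ℝ (fun z => W z 1) y (liftPoint (EuclideanSpace.single 1 1) 0) +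
      fderiv ℝ (fun z => W z 2) y (liftPoint 0 1) := fun y => by
    have hd := hW.differentiable one_ne_zero y
    rw [divergence_eq_sum, Fin.sum_univ_three, fderiv_coord hd, fderiv_coord hd, fderiv_coord hd,
      ← single_two_eq_liftPoint, ← single_two_eq_liftPoint, ← single_eq_liftPoint_zero_one]
    rfl
  simp only [e1]
  have i1 := (hint 0 (liftPoint (EuclideanSpace.single 0 1) 0)).integrableOn (s := subgraph g)
  have i2 := (hint 1 (liftPoint (EuclideanSpace.single 1 1) 0)).integrableOn (s := subgraph g)
  rw [integral_add (f := fun y => fderiv ℝ (fun z => W z 0) y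
      (liftPoint (EuclideanSpace.single 0 1) 0) + fderiv ℝ (fun z => W z 1) y
      (liftPoint (EuclideanSpace.single 1 1) 0)) (i1.add i2) (hint 2 _).integrableOn, integral_add i1 i2,
    integral_subgraph_fderiv hg (hWi 0) (hci 0), integral_subgraph_fderiv hg (hWi 1) (hci 1),
    integral_subgraph_fderiv hg (hWi 2) (hci 2), ← integral_add (hint2 _ _ _) (hint2 _ _ _),
    ← integral_add (f := fun x => W (graphMap g x) 0 * (0 - fderiv ℝ g x
      (EuclideanSpace.single 0 1)) + W (graphMap g x) 1 * (0 - fderiv ℝ g x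
      (EuclideanSpace.single 1 1))) ((hint2 _ _ _).add (hint2 _ _ _)) (hint2 _ _ _)]
  congr 1
  funext x
  simp [graphNormal, PiLp.inner_apply, Fin.sum_univ_three]
  ring

lemma mem_subgraph_of_shift {g : E2 → ℝ} {t : ℝ} (ht : 0 < t) {y : E3}
    (hy : y 2 ≤ g (horizontal y) - t) : y ∈ subgraph g := by
  change y 2 < _; linarith

lemma exists_contDiff_one_nhds_of_subset_interior {s t : Set E3} (hs : IsClosed s)
    (hst : s ⊆ interior t) : ∃ χ : E3 → ℝ, ContDiff ℝ 1 χ ∧ (∀ y ∈ s, ∀ᶠ z in 𝓝 y, χ z = 1) ∧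
      ∀ y ∉ t, χ y = 0 := by
  obtain ⟨χ, h1, h0, -⟩ := exists_contMDiffMap_one_nhds_of_subset_interior (n := ⊤) 𝓘(ℝ, E3) hs hst
  have h2 : ContDiff ℝ (∞ : WithTop ℕ∞) (fun y => χ y) := contMDiff_iff_contDiff.1 χ.contMDiff
  exact ⟨fun y => χ y, h2.of_le (by exact_mod_cast le_top), eventually_nhdsSet_iff_forall.1 h1, h0⟩

/-- A field which is `C¹` below a graph coincides, at a positive distance below the graph, with
a field which is `C¹` everywhere. -/
lemma exists_contDiff_eq_below {g : E2 → ℝ} (hg : Continuous g) {W : E3 → E3}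
    (hW : ContDiffOn ℝ 1 W (subgraph g)) (hc : HasCompactSupport W) {t : ℝ} (ht : 0 < t) :
    ∃ V : E3 → E3, ContDiff ℝ 1 V ∧ HasCompactSupport V ∧
      ∀ y : E3, y 2 ≤ g (horizontal y) - t → V =ᶠ[𝓝 y] W := by
  have hcl : ∀ r, IsClosed {y : E3 | y 2 ≤ g (horizontal y) - r} := fun r =>
    isClosed_le (by fun_prop) ((hg.comp continuous_horizontal).sub continuous_const)
  have hop : ∀ r, IsOpen {y : E3 | y 2 < g (horizontal y) - r} := fun r =>
    isOpen_lt (by fun_prop) ((hg.comp continuous_horizontal).sub continuous_const)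
  have hsub : {y : E3 | y 2 ≤ g (horizontal y) - t} ⊆
      interior {y : E3 | y 2 ≤ g (horizontal y) - t / 2} :=
    fun y hy => interior_maximal (t := {y : E3 | y 2 < g (horizontal y) - t / 2})
      (fun z (hz : z 2 < _) => hz.le) (hop (t / 2)) (by
        change y 2 ≤ g (horizontal y) - t at hy
        change y 2 < g (horizontal y) - t / 2
        linarith)
  obtain ⟨χ, hχ, h1, h0⟩ := exists_contDiff_one_nhds_of_subset_interior (hcl t) hsub
  -- The cutoff is `1` near depths at least `t` and `0` at depths less than `t / 2`, so the product
  -- is smooth below the graph and vanishes near every other point.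
  refine ⟨fun y => χ y • W y, contDiff_iff_contDiffAt.2 fun y => ?_, 
    hc.mono fun y hy h => hy (by simp [h]), fun y hy => ?_⟩
  · by_cases hy : y ∈ subgraph g
    · exact hχ.contDiffAt.smul (hW.contDiffAt ((isOpen_subgraph hg).mem_nhds hy))
    · have : (fun y => χ y • W y) =ᶠ[𝓝 y] fun _ => 0 := by
        filter_upwards [(hcl (t / 2)).isOpen_compl.mem_nhds (show y ∈ _ from fun hy' =>
          hy (mem_subgraph_of_shift (half_pos ht) hy'))] with z hz
        rw [h0 z hz, zero_smul]
      exact contDiffAt_const.congr_of_eventuallyEq this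
  · filter_upwards [h1 y hy] with z hz
    rw [hz, one_smul]

/-- The divergence theorem below a Lipschitz graph, for fields which are continuous up to the graph
and differentiable below it. -/
theorem integral_subgraph_divergence {g : E2 → ℝ} {K : ℝ≥0} (hg : LipschitzWith K g)
    {W : E3 → E3} (hW : ContDiffOn ℝ 1 W (subgraph g))
    (hWc : ContinuousOn W {y | y 2 ≤ g (horizontal y)}) (hc : HasCompactSupport W)
    (hdiv : IntegrableOn (divergence W) (subgraph g)) :
    ∫ y in subgraph g, divergence W y =
      ∫ x, inner ℝ (W (graphMap g x)) (graphNormal g x) := by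
  have hgc := hg.continuous
  -- The region is exhausted from inside by lowering the graph by `t n`. Vertical translation does
  -- not change the normal, so on the right-hand side only the argument of `W` varies with `n`.
  let t : ℕ → ℝ := fun n => 1 / ((n : ℝ) + 1)
  have ht : ∀ n, 0 < t n := fun n => by positivity
  have ht0 : Tendsto t atTop (𝓝 0) := tendsto_one_div_add_atTop_nhds_zero_nat
  have hgt : ∀ n, LipschitzWith K fun x => g x - t n := fun n => by
    simpa using hg.sub (LipschitzWith.const (t n))
  have hcl : IsClosed {y : E3 | y 2 ≤ g (horizontal y)} :=
    isClosed_le (by fun_prop) (hgc.comp continuous_horizontal)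
  have hbelow : ∀ n x, graphMap (fun x => g x - t n) x ∈ {y : E3 | y 2 ≤ g (horizontal y)} :=
    fun n x => by simp [graphMap, (ht n).le]
  have step : ∀ n, ∫ y in subgraph (fun x => g x - t n), divergence W y =
      ∫ x, inner ℝ (W (graphMap (fun x => g x - t n) x)) (graphNormal g x) := fun n => by
    obtain ⟨V, hV, hVc, hVW⟩ := exists_contDiff_eq_below hgc hW hc (ht n)
    have h := integral_subgraph_divergence_of_contDiff (hgt n) hV hVc
    have e1 : ∫ y in subgraph (fun x => g x - t n), divergence W y =
        ∫ y in subgraph (fun x => g x - t n), divergence V y :=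
      setIntegral_congr_fun (isOpen_subgraph (hgt n).continuous).measurableSet
        fun y hy => (divergence_congr (hVW y (le_of_lt hy))).symm
    rw [e1, h]
    congr 1
    funext x
    rw [(hVW _ (by simp [graphMap])).eq_of_nhds]
    simp only [graphNormal, fderiv_sub_const]
  have hmono : Monotone fun n => subgraph fun x => g x - t n := fun m n hmn y hy => by
    have : t n ≤ t m := Nat.one_div_le_one_div hmn
    change y 2 < _ - _ at hy; change y 2 < _ - _; linarith
  have hunion : ⋃ n, subgraph (fun x => g x - t n) = subgraph g := by
    ext y
    rw [mem_iUnion]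
    constructor
    · rintro ⟨n, hn⟩
      exact mem_subgraph_of_shift (ht n) (le_of_lt hn)
    · intro hy
      obtain ⟨n, hn⟩ := exists_nat_one_div_lt (sub_pos.2 (show y 2 < g (horizontal y) from hy))
      exact ⟨n, by change y 2 < _ - 1 / ((n : ℝ) + 1); linarith⟩
  have hL := tendsto_setIntegral_of_monotone (μ := volume)
    (fun n => (isOpen_subgraph (hgt n).continuous).measurableSet) hmono
    (by rw [hunion]; exact hdiv)
  rw [hunion] at hL
  obtain ⟨C, hC⟩ : ∃ C, ∀ y ∈ {y : E3 | y 2 ≤ g (horizontal y)}, ‖W y‖ ≤ C := by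
    obtain ⟨C, hC⟩ := (hc.isCompact.inter_left hcl).exists_bound_of_continuousOn
      (hWc.mono inter_subset_left)
    refine ⟨max C 0, fun y hy => ?_⟩
    by_cases hy' : y ∈ tsupport W
    · exact (hC y ⟨hy, hy'⟩).trans (le_max_left _ _)
    · simp [image_eq_zero_of_notMem_tsupport hy']
  have hR : Tendsto (fun n => ∫ x, inner ℝ (W (graphMap (fun x => g x - t n) x)) (graphNormal g x))
      atTop (𝓝 (∫ x, inner ℝ (W (graphMap g x)) (graphNormal g x))) := by
    have hKc : IsCompact (horizontal '' tsupport W) := hc.image continuous_horizontal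
    -- All integrands vanish off the shadow of the support of `W`, and on it they are at most the
    -- bound for `W` times the bound for the area density.
    refine tendsto_integral_of_dominated_convergence
      ((horizontal '' tsupport W).indicator fun _ => C * (1 + 2 * K)) (fun n => ?_) ?_
      (fun n => ae_of_all _ fun x => ?_) (ae_of_all _ fun x => ?_)
    · have : Continuous fun x => W (graphMap (fun x => g x - t n) x) :=
        hWc.comp_continuous (continuous_graphMap (hgt n).continuous) (hbelow n)
      exact this.aestronglyMeasurable.inner (measurable_graphNormal g).aestronglyMeasurable
    · exact (integrable_indicator_iff hKc.measurableSet).2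
        (integrableOn_const hKc.measure_lt_top.ne)
    · by_cases hx : x ∈ horizontal '' tsupport W
      · rw [indicator_of_mem hx]
        refine (norm_inner_le_norm _ _).trans ?_
        rw [norm_graphNormal]
        exact mul_le_mul (hC _ (hbelow n x)) (graphDensity_le hg x)
          (areaFactor_pos _).le ((norm_nonneg _).trans (hC _ (hbelow n x)))
      · rw [indicator_of_notMem hx, image_eq_zero_of_notMem_tsupport (f := W) fun h =>
          hx ⟨_, h, by simp [graphMap]⟩]
        simp
    · refine Tendsto.inner ?_ tendsto_const_nhds
      have h1 : Tendsto (fun n => graphMap (fun x => g x - t n) x) atTop (𝓝 (graphMap g x)) := by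
        have h2 : Tendsto (fun n => liftCLM (x, g x - t n)) atTop (𝓝 (liftCLM (x, g x - 0))) :=
          liftCLM.continuous.continuousAt.tendsto.comp
            (tendsto_const_nhds.prodMk_nhds (tendsto_const_nhds.sub ht0))
        simpa [graphMap] using h2
      exact ((hWc (graphMap g x) (by simp [graphMap])).tendsto).comp
        (tendsto_nhdsWithin_iff.2 ⟨h1, Eventually.of_forall fun n => hbelow n x⟩)
  simp only [step] at hL
  exact tendsto_nhds_unique hL hR

/-! ### Exterior normals and graph charts. -/

/-- For distinct unit vectors, `n' - n` has negative inner product with `n` and positive inner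
product with `n'`. A short step from `Q` in that direction would lie both inside and outside `Ω`;
`ε` is half the value at which the cone conditions would fail. -/
lemma IsExteriorUnitNormal.unique {Ω : Set E3} {Q n n' : E3} (h : IsExteriorUnitNormal Ω Q n)
    (h' : IsExteriorUnitNormal Ω Q n') : n = n' := by
  by_contra hne
  have hlt : inner ℝ n n' < 1 := by
    exact (inner_lt_one_iff_real_of_norm_eq_one h.1 h'.1).2 hne
  set w := n' - n with hw
  have hw1 : inner ℝ w n = inner ℝ n n' - 1 := by
    rw [hw, inner_sub_left, real_inner_self_eq_norm_sq, h.1, real_inner_comm]; norm_num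
  have hw2 : inner ℝ w n' = 1 - inner ℝ n n' := by
    rw [hw, inner_sub_left, real_inner_self_eq_norm_sq, h'.1]; norm_num
  have hw0 : 0 < ‖w‖ := norm_pos_iff.2 (sub_ne_zero.2 (Ne.symm hne))
  set ε := (1 - inner ℝ n n') / (2 * ‖w‖) with hε
  have hε0 : 0 < ε := by have := sub_pos.2 hlt; positivity
  have hεw : ε * ‖w‖ = (1 - inner ℝ n n') / 2 := by rw [hε]; field_simp
  obtain ⟨δ, hδ, H⟩ := h.2 ε hε0
  obtain ⟨δ', hδ', H'⟩ := h'.2 ε hε0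
  set t := min δ δ' / (2 * ‖w‖) with ht
  have ht0 : 0 < t := by have := lt_min hδ hδ'; positivity
  have htw : t * ‖w‖ = min δ δ' / 2 := by rw [ht]; field_simp
  have hnorm : ‖(Q + t • w) - Q‖ = t * ‖w‖ := by
    rw [add_sub_cancel_left, norm_smul, Real.norm_of_nonneg ht0.le]
  have hmin := lt_min hδ hδ'
  have hb : ∀ d, min δ δ' ≤ d → Q + t • w ∈ ball Q d := fun d hd => by
    rw [mem_ball, dist_eq_norm, hnorm, htw]; linarith
  refine (H' _ (hb _ (min_le_right _ _))).2 ?_ ((H _ (hb _ (min_le_left _ _))).1 ?_)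
  · rw [hnorm, add_sub_cancel_left, inner_smul_left, hw2]
    simp only [conj_trivial]
    nlinarith [mul_pos ht0 (sub_pos.2 hlt)]
  · rw [hnorm, add_sub_cancel_left, inner_smul_left, hw1]
    simp only [conj_trivial]
    nlinarith [mul_pos ht0 (sub_pos.2 hlt)]

lemma IsExteriorUnitNormal.exteriorNormal_eq {Ω : Set E3} {Q n : E3}
    (h : IsExteriorUnitNormal Ω Q n) : exteriorNormal Ω Q = n := by
  have hex : ∃ n, IsExteriorUnitNormal Ω Q n := ⟨n, h⟩
  rw [exteriorNormal, dif_pos hex]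
  exact hex.choose_spec.unique h

lemma norm_exteriorNormal_le (Ω : Set E3) (Q : E3) : ‖exteriorNormal Ω Q‖ ≤ 1 := by
  unfold exteriorNormal
  split_ifs with h
  · exact h.choose_spec.1.le
  · simp

/-- In the ball of radius `r` around `p`, and in the coordinates `e`, the set `Ω` lies below the
graph of the `K`-Lipschitz function `g`. -/
structure IsGraphChart (Ω : Set E3) (p : E3) (r : ℝ) (e : E3 ≃ₗᵢ[ℝ] E3) (g : E2 → ℝ)
    (K : ℝ≥0) : Prop where
  isOpen : IsOpen Ω
  lipschitz : LipschitzWith K g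
  mem_iff : ∀ x ∈ ball p r, x ∈ Ω ↔ e x ∈ subgraph g

lemma IsLipschitzDomain.exists_graphChart {Ω : Set E3} (hΩ : IsLipschitzDomain Ω) {p : E3}
    (hp : p ∈ closure Ω) : ∃ r > 0, ∃ e g K, IsGraphChart Ω p r e g K := by
  by_cases hpΩ : p ∈ Ω
  · obtain ⟨r, hr, hb⟩ := Metric.isOpen_iff.1 hΩ.isOpen p hpΩ
    -- At an interior point the constant graph at height `p 2 + r` passes above the whole ball, so
    -- interior and boundary points can be treated alike.
    refine ⟨r, hr, LinearIsometryEquiv.refl ℝ E3, fun _ => p 2 + r, 0, hΩ.isOpen,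
      LipschitzWith.const _, fun x hx => ⟨fun _ => ?_, fun _ => hb hx⟩⟩
    change x 2 < p 2 + r
    rw [mem_ball, dist_eq_norm] at hx
    have := (PiLp.norm_apply_le (x - p) 2).trans_lt hx
    have := (abs_lt.1 this).2
    simp only [PiLp.sub_apply] at this
    linarith
  · obtain ⟨e, g, K, r, hg, hr, h⟩ := hΩ.localGraph p
      ⟨hp, fun h => hpΩ (interior_subset h)⟩
    exact ⟨r, hr, e, g, K, hΩ.isOpen, hg, h⟩

lemma closure_subgraph {g : E2 → ℝ} (hg : Continuous g) :
    closure (subgraph g) = {y | y 2 ≤ g (horizontal y)} := by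
  refine Subset.antisymm (closure_minimal (fun y (hy : y 2 < _) => hy.le)
    (isClosed_le (by fun_prop) (hg.comp continuous_horizontal))) fun y hy => ?_
  have h : Tendsto (fun s : ℝ => liftCLM (horizontal y, y 2 - s)) (𝓝[>] 0) (𝓝 y) := by
    have : Continuous fun s : ℝ => liftCLM (horizontal y, y 2 - s) := by fun_prop
    simpa using (this.tendsto 0).mono_left nhdsWithin_le_nhds
  refine mem_closure_of_tendsto h (eventually_mem_nhdsWithin.mono fun s hs => ?_)
  have hs' : 0 < s := hs
  have hy' : y 2 ≤ g (horizontal y) := hy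
  simp only [subgraph, liftCLM_apply, mem_ofPred_eq, liftPoint_two, horizontal_liftPoint]
  linarith

namespace IsGraphChart

variable {Ω : Set E3} {p : E3} {r : ℝ} {e : E3 ≃ₗᵢ[ℝ] E3} {g : E2 → ℝ} {K : ℝ≥0}

lemma mem_closure_iff (h : IsGraphChart Ω p r e g K) {x : E3} (hx : x ∈ ball p r) :
    x ∈ closure Ω ↔ (e x) 2 ≤ g (horizontal (e x)) := by
  have e1 : x ∈ closure Ω ↔ x ∈ closure (e ⁻¹' subgraph g) := by
    rw [mem_closure_iff_frequently, mem_closure_iff_frequently]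
    refine frequently_congr ?_
    filter_upwards [isOpen_ball.mem_nhds hx] with y hy using h.mem_iff y hy
  have e2 : e ⁻¹' closure (subgraph g) = closure (e ⁻¹' subgraph g) :=
    e.toHomeomorph.preimage_closure _
  rw [e1, ← e2, closure_subgraph h.lipschitz.continuous]
  rfl

lemma mem_frontier_iff (h : IsGraphChart Ω p r e g K) {x : E3} (hx : x ∈ ball p r) :
    x ∈ frontier Ω ↔ x ∈ range fun z => e.symm (graphMap g z) := by
  have e1 : x ∈ (range fun z => e.symm (graphMap g z)) ↔ e x ∈ range (graphMap g) :=
    ⟨fun ⟨z, hz⟩ => ⟨z, by rw [← hz]; simp⟩, fun ⟨z, hz⟩ => ⟨z, by simp [hz]⟩⟩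
  rw [e1, range_graphMap, h.isOpen.frontier_eq, Set.mem_sdiff, h.mem_closure_iff hx, h.mem_iff x hx]
  change _ ∧ ¬ ((e x) 2 < g (horizontal (e x))) ↔ (e x) 2 = g (horizontal (e x))
  rw [not_lt, le_antisymm_iff]

lemma measurableEmbedding (h : IsGraphChart Ω p r e g K) :
    MeasurableEmbedding fun z => e.symm (graphMap g z) :=
  e.symm.toHomeomorph.measurableEmbedding.comp (measurableEmbedding_graphMap h.lipschitz.continuous)

/-- In a graph chart, the surface measure is the image of Lebesgue measure with the area density. -/
lemma surfaceMeasure_restrict (h : IsGraphChart Ω p r e g K) :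
    (surfaceMeasure Ω).restrict (ball p r) =
      ((volume.withDensity fun x => ENNReal.ofReal (graphDensity g x)).map
        fun z => e.symm (graphMap g z)).restrict (ball p r) := by
  have hm := h.measurableEmbedding
  have e1 : (μHE[2] : Measure E3).restrict (range fun z => e.symm (graphMap g z)) =
      (volume.withDensity fun x => ENNReal.ofReal (graphDensity g x)).map
        fun z => e.symm (graphMap g z) := by
    have hpre : e.symm.toIsometryEquiv ⁻¹' (range fun z => e.symm (graphMap g z)) =
        range (graphMap g) := by
      ext y
      exact ⟨fun ⟨z, hz⟩ => ⟨z, e.symm.injective hz⟩, fun ⟨z, hz⟩ => ⟨z, congrArg e.symm hz⟩⟩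
    have hmp := (e.symm.toIsometryEquiv.measurePreserving_euclideanHausdorffMeasure
      2).restrict_preimage hm.measurableSet_range
    rw [hpre] at hmp
    rw [← hmp.map_eq, euclideanHausdorffMeasure_restrict_graph h.lipschitz, Measure.map_map
      e.symm.toIsometryEquiv.continuous.measurable (continuous_graphMap h.lipschitz.continuous).measurable]
    rfl
  rw [← e1, surfaceMeasure, Measure.restrict_restrict measurableSet_ball,
    Measure.restrict_restrict measurableSet_ball]
  congr 1
  ext x
  exact and_congr_right fun hx => h.mem_frontier_iff hx

lemma surfaceMeasure_ball_lt_top (h : IsGraphChart Ω p r e g K) :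
    surfaceMeasure Ω (ball p r) < ⊤ := by
  have hm := h.measurableEmbedding
  rw [← Measure.restrict_apply_self, h.surfaceMeasure_restrict, Measure.restrict_apply_self,
    hm.map_apply, withDensity_apply _ (hm.measurable measurableSet_ball)]
  calc _ ≤ ∫⁻ _ in (fun z => e.symm (graphMap g z)) ⁻¹' ball p r, ENNReal.ofReal (1 + 2 * K) :=
        lintegral_mono fun x => ENNReal.ofReal_le_ofReal (graphDensity_le h.lipschitz x)
    _ = ENNReal.ofReal (1 + 2 * K) * volume ((fun z => e.symm (graphMap g z)) ⁻¹' ball p r) :=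
        setLIntegral_const _ _
    _ < ⊤ := by
        refine ENNReal.mul_lt_top ENNReal.ofReal_lt_top (lt_of_le_of_lt (measure_mono ?_)
          (measure_ball_lt_top (x := horizontal (e p)) (r := r)))
        intro z hz
        have hz' : ‖graphMap g z - e p‖ < r := by
          have : e.symm (graphMap g z) ∈ ball p r := hz
          rw [mem_ball, dist_eq_norm, ← e.norm_map, map_sub, e.apply_symm_apply] at this
          exact this
        rw [mem_ball, dist_eq_norm]
        refine lt_of_le_of_lt ?_ hz'
        conv_rhs => rw [← liftPoint_horizontal (e p), graphMap, liftPoint_sub]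
        exact norm_le_norm_liftPoint _ _

/-- In chart coordinates, the inner product with the unit normal is the height above the tangent
plane divided by the area density. Differentiability puts the graph within `ε` times the distance of
that plane, and since the density is at least `1`, a point outside the `ε`-cone is on the expected
side of the graph. -/
lemma isExteriorUnitNormal (h : IsGraphChart Ω p r e g K) {x : E2} (hx : DifferentiableAt ℝ g x)
    (hb : e.symm (graphMap g x) ∈ ball p r) :
    IsExteriorUnitNormal Ω (e.symm (graphMap g x))
      (e.symm ((graphDensity g x)⁻¹ • graphNormal g x)) := by
  have hJ : 0 < graphDensity g x := areaFactor_pos _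
  have hJ1 : 1 ≤ graphDensity g x := one_le_areaFactor _
  refine ⟨?_, fun ε hε => ?_⟩
  · rw [e.symm.norm_map, norm_smul, norm_graphNormal, norm_inv, Real.norm_of_nonneg hJ.le,
      inv_mul_cancel₀ hJ.ne']
  have hlin := (hasFDerivAt_iff_isLittleO.1 hx.hasFDerivAt).def hε
  obtain ⟨δ₁, hδ₁, H₁⟩ := Metric.eventually_nhds_iff_ball.1 hlin
  obtain ⟨δ₂, hδ₂, H₂⟩ := Metric.isOpen_iff.1 isOpen_ball _ hb
  refine ⟨min δ₁ δ₂, lt_min hδ₁ hδ₂, fun y hy => ?_⟩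
  have hyb : y ∈ ball p r := H₂ (ball_subset_ball (min_le_right _ _) hy)
  set z := e y with hz
  have hsub : e (y - e.symm (graphMap g x)) = liftPoint (horizontal z - x) (z 2 - g x) := by
    rw [map_sub, e.apply_symm_apply, ← hz, graphMap, ← liftPoint_sub, liftPoint_horizontal]
  have hn : ‖y - e.symm (graphMap g x)‖ = ‖liftPoint (horizontal z - x) (z 2 - g x)‖ := by
    rw [← hsub, e.norm_map]
  have hle : ‖horizontal z - x‖ ≤ ‖y - e.symm (graphMap g x)‖ := by
    rw [hn]; exact norm_le_norm_liftPoint _ _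
  have h1 : |g (horizontal z) - g x - fderiv ℝ g x (horizontal z - x)| ≤
      ε * ‖y - e.symm (graphMap g x)‖ := by
    refine (H₁ (horizontal z) ?_).trans (mul_le_mul_of_nonneg_left hle hε.le)
    rw [mem_ball, dist_eq_norm]
    refine hle.trans_lt (lt_of_lt_of_le ?_ (min_le_left δ₁ δ₂))
    rwa [mem_ball, dist_eq_norm] at hy
  have hinner : inner ℝ (y - e.symm (graphMap g x))
      (e.symm ((graphDensity g x)⁻¹ • graphNormal g x)) =
      (graphDensity g x)⁻¹ * (z 2 - g x - fderiv ℝ g x (horizontal z - x)) := by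
    rw [← e.inner_map_map, hsub, e.apply_symm_apply, inner_smul_right]
    congr 1
    have hv : horizontal z - x = (horizontal z - x) 0 • EuclideanSpace.single 0 (1 : ℝ) +
        (horizontal z - x) 1 • EuclideanSpace.single 1 (1 : ℝ) := by
      ext i; fin_cases i <;> simp
    conv_rhs => rw [hv, map_add, map_smul, map_smul]
    simp [graphNormal, PiLp.inner_apply, Fin.sum_univ_three]
    ring
  have hN := norm_nonneg (y - e.symm (graphMap g x))
  have hεN : ε * ‖y - e.symm (graphMap g x)‖ ≤
      graphDensity g x * (ε * ‖y - e.symm (graphMap g x)‖) :=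
    le_mul_of_one_le_left (by positivity) hJ1
  have hab := abs_le.1 h1
  rw [hinner, h.mem_iff y hyb]
  change (_ → z 2 < g (horizontal z)) ∧ (_ → ¬ (z 2 < g (horizontal z)))
  constructor
  · intro hlt
    rw [inv_mul_eq_div, div_lt_iff₀ hJ] at hlt
    nlinarith
  · intro hlt
    rw [inv_mul_eq_div, lt_div_iff₀ hJ] at hlt
    nlinarith

lemma ae_differentiableAt (h : IsGraphChart Ω p r e g K) :
    ∀ᵐ x ∂(volume.withDensity fun x => ENNReal.ofReal (graphDensity g x)),
      DifferentiableAt ℝ g x :=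
  (withDensity_absolutelyContinuous _ _).ae_le h.lipschitz.ae_differentiableAt

lemma ae_isExteriorUnitNormal (h : IsGraphChart Ω p r e g K) :
    ∀ᵐ Q ∂((surfaceMeasure Ω).restrict (ball p r)),
      IsExteriorUnitNormal Ω Q (exteriorNormal Ω Q) := by
  rw [h.surfaceMeasure_restrict, ae_restrict_iff' measurableSet_ball,
    h.measurableEmbedding.ae_map_iff]
  filter_upwards [h.ae_differentiableAt] with x hx hb
  have := h.isExteriorUnitNormal hx hb
  rwa [this.exteriorNormal_eq]

lemma aestronglyMeasurable_exteriorNormal (h : IsGraphChart Ω p r e g K) :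
    AEStronglyMeasurable (exteriorNormal Ω) ((surfaceMeasure Ω).restrict (ball p r)) := by
  have hm := h.measurableEmbedding
  rw [h.surfaceMeasure_restrict, hm.restrict_map, hm.aestronglyMeasurable_map_iff]
  have hmeas : Measurable fun x => e.symm ((graphDensity g x)⁻¹ • graphNormal g x) :=
    e.symm.continuous.measurable.comp
      ((measurable_graphDensity g).inv.smul (measurable_graphNormal g))
  refine hmeas.aestronglyMeasurable.congr ?_
  filter_upwards [ae_restrict_of_ae h.ae_differentiableAt,
    ae_restrict_mem (hm.measurable measurableSet_ball)] with x hx hb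
  exact (h.isExteriorUnitNormal hx hb).exteriorNormal_eq.symm

lemma integral_surfaceMeasure (h : IsGraphChart Ω p r e g K) {f : E3 → ℝ}
    (hf : ∀ x ∉ ball p r, f x = 0) :
    ∫ Q, f Q ∂(surfaceMeasure Ω) = ∫ x, graphDensity g x * f (e.symm (graphMap g x)) := by
  rw [← setIntegral_eq_integral_of_forall_compl_eq_zero hf, h.surfaceMeasure_restrict,
    setIntegral_eq_integral_of_forall_compl_eq_zero hf, h.measurableEmbedding.integral_map,
    integral_withDensity_eq_integral_toReal_smul (measurable_graphDensity g).ennreal_ofReal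
      (ae_of_all _ fun _ => ENNReal.ofReal_lt_top)]
  congr 1
  funext x
  rw [ENNReal.toReal_ofReal (show 0 ≤ graphDensity g x from (areaFactor_pos _).le), smul_eq_mul]

/-- The area density cancels the normalisation of the normal, leaving `(-∇g, 1)`, as in the
divergence theorem below a graph. -/
lemma integral_inner_exteriorNormal (h : IsGraphChart Ω p r e g K) {V : E3 → E3}
    (hV : ∀ x ∉ ball p r, V x = 0) :
    ∫ Q, inner ℝ (V Q) (exteriorNormal Ω Q) ∂(surfaceMeasure Ω) =
      ∫ x, inner ℝ (e (V (e.symm (graphMap g x)))) (graphNormal g x) := by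
  rw [h.integral_surfaceMeasure fun x hx => by rw [hV x hx, inner_zero_left]]
  refine integral_congr_ae ?_
  filter_upwards [h.lipschitz.ae_differentiableAt] with x hx
  by_cases hb : e.symm (graphMap g x) ∈ ball p r
  · have hJ : graphDensity g x ≠ 0 := (areaFactor_pos _).ne'
    rw [(h.isExteriorUnitNormal hx hb).exteriorNormal_eq, ← e.inner_map_map, e.apply_symm_apply,
      inner_smul_right, mul_inv_cancel_left₀ hJ]
  · simp [hV _ hb]

end IsGraphChart

/-! ### The divergence theorem on bounded Lipschitz domains. -/

/-- The derivative is conjugated by `e`, and the trace is invariant under conjugation. -/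
lemma divergence_conj (e : E3 ≃ₗᵢ[ℝ] E3) (V : E3 → E3) (y : E3) :
    divergence (fun z => e (V (e.symm z))) y = divergence V (e.symm y) := by
  have h1 : fderiv ℝ (fun z => e (V (e.symm z))) y =
      (e : E3 →L[ℝ] E3).comp ((fderiv ℝ V (e.symm y)).comp (e.symm : E3 →L[ℝ] E3)) := by
    have h2 := e.toContinuousLinearEquiv.comp_fderiv (f := fun z => V (e.symm z)) (x := y)
    have h3 := e.symm.toContinuousLinearEquiv.comp_right_fderiv (f := V) (x := y)
    exact h2.trans (congrArg _ h3)
  rw [divergence, divergence, h1]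
  exact LinearMap.trace_conj' (fderiv ℝ V (e.symm y) : E3 →ₗ[ℝ] E3) e.toLinearEquiv

lemma divergence_eq_zero_of_notMem_tsupport {V : E3 → E3} {y : E3} (h : y ∉ tsupport V) :
    divergence V y = 0 := by
  rw [divergence_congr (notMem_tsupport_iff_eventuallyEq.1 h), divergence]
  simp

/-- The divergence theorem for fields supported in a graph chart. -/
theorem IsGraphChart.integral_divergence {Ω : Set E3} {p : E3} {r : ℝ} {e : E3 ≃ₗᵢ[ℝ] E3}
    {g : E2 → ℝ} {K : ℝ≥0} (h : IsGraphChart Ω p r e g K) {V : E3 → E3}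
    (hVc : ContinuousOn V (closure Ω)) (hV : ContDiffOn ℝ 1 V Ω) (hs : tsupport V ⊆ ball p r)
    (hdiv : IntegrableOn (divergence V) Ω) :
    ∫ y in Ω, divergence V y = ∫ Q, inner ℝ (V Q) (exteriorNormal Ω Q) ∂(surfaceMeasure Ω) := by
  have hgc := h.lipschitz.continuous
  have hV0 : ∀ x ∉ ball p r, V =ᶠ[𝓝 x] 0 := fun x hx =>
    notMem_tsupport_iff_eventuallyEq.1 fun hx' => hx (hs hx')
  have hVcs : HasCompactSupport V :=
    HasCompactSupport.of_support_subset_isCompact (isCompact_closedBall p r)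
      ((subset_tsupport V).trans (hs.trans ball_subset_closedBall))
  set W : E3 → E3 := fun y => e (V (e.symm y)) with hW
  have hWcs : HasCompactSupport W :=
    (hVcs.comp_homeomorph e.symm.toHomeomorph).comp_left (g := e) e.map_zero
  have hW0 : ∀ y, e.symm y ∉ ball p r → W =ᶠ[𝓝 y] 0 := fun y hy => by
    have h1 : ∀ᶠ z in 𝓝 y, V (e.symm z) = 0 :=
      e.symm.continuous.continuousAt.eventually (hV0 _ hy)
    filter_upwards [h1] with z hz
    simp [hW, hz]
  have hWd : ContDiffOn ℝ 1 W (subgraph g) := fun y hy => by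
    by_cases hb : e.symm y ∈ ball p r
    · have hyΩ : e.symm y ∈ Ω := (h.mem_iff _ hb).2 (by rwa [e.apply_symm_apply])
      have h1 : ContDiffAt ℝ 1 V (e.symm y) := hV.contDiffAt (h.isOpen.mem_nhds hyΩ)
      have h2 : ContDiffAt ℝ 1 (fun z => V (e.symm z)) y :=
        h1.comp y e.symm.contDiff.contDiffAt
      exact (e.contDiff.contDiffAt.comp y h2).contDiffWithinAt
    · exact (contDiffAt_const.congr_of_eventuallyEq (hW0 y hb)).contDiffWithinAt
  have hWc : ContinuousOn W {y | y 2 ≤ g (horizontal y)} := fun y hy => by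
    by_cases hb : e.symm y ∈ ball p r
    · have hcl : e.symm y ∈ closure Ω := (h.mem_closure_iff hb).2 (by rwa [e.apply_symm_apply])
      have h1 : Tendsto e.symm (𝓝[{y | y 2 ≤ g (horizontal y)}] y) (𝓝[closure Ω] (e.symm y)) := by
        refine tendsto_nhdsWithin_iff.2
          ⟨e.symm.continuous.continuousAt.tendsto.mono_left nhdsWithin_le_nhds, ?_⟩
        filter_upwards [self_mem_nhdsWithin, nhdsWithin_le_nhds
          (e.symm.continuous.continuousAt.preimage_mem_nhds (isOpen_ball.mem_nhds hb))] with z hz hzb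
        exact (h.mem_closure_iff hzb).2 (by rwa [e.apply_symm_apply])
      exact e.continuous.continuousAt.tendsto.comp ((hVc _ hcl).tendsto.comp h1)
    · exact (continuousAt_const.congr (hW0 y hb).symm).continuousWithinAt
  have hdW : divergence W = fun y => divergence V (e.symm y) := funext (divergence_conj e V)
  have hmp : MeasurePreserving e.symm (volume : Measure E3) volume := e.symm.measurePreserving
  have hme : MeasurableEmbedding e.symm := e.symm.toHomeomorph.measurableEmbedding
  have hpre : e.symm ⁻¹' (e ⁻¹' subgraph g) = subgraph g := by ext; simp
  -- The domain and the subgraph agree only inside the ball; the divergence of `V` vanishes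
  -- elsewhere, so the two integrals coincide.
  have hinter : (e ⁻¹' subgraph g) ∩ ball p r = Ω ∩ ball p r := by
    ext x; exact and_congr_left fun hx => (h.mem_iff x hx).symm
  have hz : ∀ x, x ∉ ball p r → divergence V x = 0 := fun x hx =>
    divergence_eq_zero_of_notMem_tsupport fun hx' => hx (hs hx')
  have hms : MeasurableSet (e ⁻¹' subgraph g) :=
    ((isOpen_subgraph hgc).preimage e.continuous).measurableSet
  have hrestr : ∀ s : Set E3, MeasurableSet s →
      ∫ y in s, divergence V y = ∫ y in s ∩ ball p r, divergence V y := fun s hs =>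
    setIntegral_eq_of_subset_of_forall_sdiff_eq_zero hs inter_subset_left
      fun x hx => hz x fun hxb => hx.2 ⟨hx.1, hxb⟩
  have hWi : IntegrableOn (divergence W) (subgraph g) := by
    rw [hdW, ← hpre]
    refine (hmp.integrableOn_comp_preimage hme (f := divergence V)).2 ?_
    refine IntegrableOn.of_forall_sdiff_eq_zero (s := (e ⁻¹' subgraph g) ∩ ball p r) ?_ hms
      fun x hx => hz x fun hxb => hx.2 ⟨hx.1, hxb⟩
    rw [hinter]
    exact hdiv.mono_set inter_subset_left
  have key := integral_subgraph_divergence h.lipschitz hWd hWc hWcs hWi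
  have hL : ∫ y in subgraph g, divergence W y = ∫ y in Ω, divergence V y := by
    rw [hdW, hrestr Ω h.isOpen.measurableSet, ← hinter, ← hrestr _ hms,
      ← hmp.setIntegral_preimage_emb hme _ (e ⁻¹' subgraph g), hpre]
  rw [← hL, key, h.integral_inner_exteriorNormal fun x hx => (hV0 x hx).eq_of_nhds]

namespace IsLipschitzDomain

variable {Ω : Set E3} (hΩ : IsLipschitzDomain Ω)
include hΩ

lemma isCompact_closure : IsCompact (closure Ω) := hΩ.isBounded.isCompact_closure

lemma exists_finset_graphChart : ∃ (t : Finset E3) (ρ : E3 → ℝ), closure Ω ⊆ ⋃ p ∈ t, ball p (ρ p) ∧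
    ∀ p ∈ t, ∃ e g K, IsGraphChart Ω p (ρ p) e g K := by
  choose! ρ hρ hchart using fun p (hp : p ∈ closure Ω) => hΩ.exists_graphChart hp
  obtain ⟨t, ht, hcov⟩ := hΩ.isCompact_closure.elim_nhds_subcover (fun p => ball p (ρ p))
    fun p hp => ball_mem_nhds p (hρ p hp)
  exact ⟨t, ρ, hcov, fun p hp => hchart p (ht p hp)⟩

omit hΩ in
lemma surfaceMeasure_restrict_of_subset {s : Set E3} (h : closure Ω ⊆ s) :
    (surfaceMeasure Ω).restrict s = surfaceMeasure Ω := by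
  refine Measure.restrict_eq_self_of_ae_mem ?_
  filter_upwards [ae_restrict_mem isClosed_frontier.measurableSet] with x hx
    using h (frontier_subset_closure hx)

lemma ae_isExteriorUnitNormal :
    ∀ᵐ Q ∂(surfaceMeasure Ω), IsExteriorUnitNormal Ω Q (exteriorNormal Ω Q) := by
  obtain ⟨t, ρ, hcov, hchart⟩ := hΩ.exists_finset_graphChart
  rw [← surfaceMeasure_restrict_of_subset hcov, ae_restrict_biUnion_finset_iff]
  intro p hp
  obtain ⟨e, g, K, h⟩ := hchart p hp
  exact h.ae_isExteriorUnitNormal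

lemma aestronglyMeasurable_exteriorNormal :
    AEStronglyMeasurable (exteriorNormal Ω) (surfaceMeasure Ω) := by
  obtain ⟨t, ρ, hcov, hchart⟩ := hΩ.exists_finset_graphChart
  have hcov' : closure Ω ⊆ ⋃ p : t, ball (p : E3) (ρ p) := by
    simpa only [iUnion_subtype] using hcov
  rw [← surfaceMeasure_restrict_of_subset hcov', aestronglyMeasurable_iUnion_iff]
  rintro ⟨p, hp⟩
  obtain ⟨e, g, K, h⟩ := hchart p hp
  exact h.aestronglyMeasurable_exteriorNormal

lemma isFiniteMeasure_surfaceMeasure : IsFiniteMeasure (surfaceMeasure Ω) := by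
  obtain ⟨t, ρ, hcov, hchart⟩ := hΩ.exists_finset_graphChart
  refine ⟨?_⟩
  rw [← surfaceMeasure_restrict_of_subset hcov, Measure.restrict_apply_univ]
  refine (measure_biUnion_finset_le t _).trans_lt (ENNReal.sum_lt_top.2 fun p hp => ?_)
  obtain ⟨e, g, K, h⟩ := hchart p hp
  exact h.surfaceMeasure_ball_lt_top

omit hΩ in
lemma _root_.ContinuousOn.aestronglyMeasurable_surfaceMeasure {F : Type*} [NormedAddCommGroup F]
    {f : E3 → F} (hf : ContinuousOn f (closure Ω)) :
    AEStronglyMeasurable f (surfaceMeasure Ω) :=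
  (hf.mono frontier_subset_closure).aestronglyMeasurable isClosed_frontier.measurableSet

lemma integrable_inner_exteriorNormal {V : E3 → E3} (hV : ContinuousOn V (closure Ω)) :
    Integrable (fun Q => inner ℝ (V Q) (exteriorNormal Ω Q)) (surfaceMeasure Ω) := by
  have := hΩ.isFiniteMeasure_surfaceMeasure
  obtain ⟨C, hC⟩ := hΩ.isCompact_closure.exists_bound_of_continuousOn hV
  refine Integrable.of_bound (hV.aestronglyMeasurable_surfaceMeasure.inner
    hΩ.aestronglyMeasurable_exteriorNormal) C ?_
  filter_upwards [ae_restrict_mem isClosed_frontier.measurableSet] with Q hQ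
  refine (norm_inner_le_norm _ _).trans ?_
  have h1 := hC Q (frontier_subset_closure hQ)
  have := norm_exteriorNormal_le Ω Q
  nlinarith [norm_nonneg (V Q), norm_nonneg (exteriorNormal Ω Q)]

omit hΩ in
lemma _root_.divergence_smul {χ : E3 → ℝ} {V : E3 → E3} {y : E3} (hχ : DifferentiableAt ℝ χ y)
    (hV : DifferentiableAt ℝ V y) :
    divergence (fun z => χ z • V z) y = χ y * divergence V y + fderiv ℝ χ y (V y) := by
  rw [divergence, fderiv_fun_smul hχ hV]
  simp only [ContinuousLinearMap.toLinearMap_add, ContinuousLinearMap.toLinearMap_smul, map_add,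
    map_smul, smul_eq_mul, divergence]
  congr 1
  exact LinearMap.trace_smulRight _ _

/-- The divergence theorem for bounded Lipschitz domains. -/
theorem integral_divergence {V : E3 → E3} (hVc : ContinuousOn V (closure Ω))
    (hV : ContDiffOn ℝ 1 V Ω) (hdiv : IntegrableOn (divergence V) Ω) :
    ∫ y in Ω, divergence V y = ∫ Q, inner ℝ (V Q) (exteriorNormal Ω Q) ∂(surfaceMeasure Ω) := by
  obtain ⟨t, ρ, hcov, hchart⟩ := hΩ.exists_finset_graphChart
  obtain ⟨f, hf⟩ := SmoothPartitionOfUnity.exists_isSubordinate 𝓘(ℝ, E3) isClosed_closure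
    (fun p : t => ball (p : E3) (ρ p)) (fun _ => isOpen_ball)
    (s := closure Ω) (by simpa only [iUnion_subtype] using hcov)
  have hfd : ∀ i, ContDiff ℝ 1 fun y => f i y := fun i =>
    (contMDiff_iff_contDiff.1 (f i).contMDiff : ContDiff ℝ (∞ : WithTop ℕ∞) fun y => f i y).of_le
      (by exact_mod_cast le_top)
  have hsum : ∀ y ∈ closure Ω, ∑ i, f i y = 1 := fun y hy => by
    rw [← finsum_eq_sum_of_fintype]; exact f.sum_eq_one hy
  have hVi : ∀ i, ContinuousOn (fun y => f i y • V y) (closure Ω) := fun i =>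
    (hfd i).continuous.continuousOn.smul hVc
  have hdV : ∀ y ∈ Ω, DifferentiableAt ℝ V y := fun y hy =>
    (hV.contDiffAt (hΩ.isOpen.mem_nhds hy)).differentiableAt one_ne_zero
  have hdi : ∀ i, IntegrableOn (divergence fun y => f i y • V y) Ω := fun i => by
    have h1 : IntegrableOn (fun y => f i y * divergence V y) Ω :=
      hdiv.bdd_mul (c := 1) (hfd i).continuous.aestronglyMeasurable
        (ae_of_all _ fun y => by
          rw [Real.norm_of_nonneg (f.nonneg i y)]; exact f.le_one i y)
    have h2 : IntegrableOn (fun y => fderiv ℝ (fun y => f i y) y (V y)) Ω :=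
      (ContinuousOn.integrableOn_compact hΩ.isCompact_closure
        (((hfd i).continuous_fderiv one_ne_zero).continuousOn.clm_apply hVc)).mono_set
          subset_closure
    refine (h1.add h2).congr_fun (fun y hy => ?_) hΩ.isOpen.measurableSet
    exact (divergence_smul ((hfd i).differentiable one_ne_zero y) (hdV y hy)).symm
  have key : ∀ i, ∫ y in Ω, divergence (fun y => f i y • V y) y =
      ∫ Q, inner ℝ (f i Q • V Q) (exteriorNormal Ω Q) ∂(surfaceMeasure Ω) := fun i => by
    obtain ⟨e, g, K, h⟩ := hchart i i.2
    exact h.integral_divergence (hVi i) ((hfd i).contDiffOn.smul hV)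
      ((tsupport_smul_subset_left _ _).trans (hf i)) (hdi i)
  have hL : ∫ y in Ω, divergence V y = ∑ i, ∫ y in Ω, divergence (fun y => f i y • V y) y := by
    rw [← integral_finsetSum _ fun i _ => hdi i]
    refine setIntegral_congr_fun hΩ.isOpen.measurableSet fun y hy => ?_
    -- The partition functions sum to `1` near `y`, so the gradient terms produced by the product
    -- rule cancel.
    have h1 : ∑ i, fderiv ℝ (fun y => f i y) y = 0 := by
      rw [← fderiv_fun_sum fun i _ => (hfd i).differentiable one_ne_zero y]
      have : (fun y => ∑ i, f i y) =ᶠ[𝓝 y] fun _ => 1 := by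
        filter_upwards [hΩ.isOpen.mem_nhds hy] with z hz using hsum z (subset_closure hz)
      rw [this.fderiv_eq, fderiv_const_apply]
    have h2 : ∀ i, divergence (fun y => f i y • V y) y =
        f i y * divergence V y + fderiv ℝ (fun y => f i y) y (V y) := fun i =>
      divergence_smul ((hfd i).differentiable one_ne_zero y) (hdV y hy)
    simp only [h2]
    rw [Finset.sum_add_distrib, ← Finset.sum_mul, hsum y (subset_closure hy), one_mul,
      ← _root_.sum_apply, h1]
    simp
  rw [hL, Finset.sum_congr rfl fun i _ => key i,
    ← integral_finsetSum _ fun i _ => hΩ.integrable_inner_exteriorNormal (hVi i)]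
  refine integral_congr_ae ?_
  filter_upwards [ae_restrict_mem isClosed_frontier.measurableSet] with Q hQ
  rw [← sum_inner, ← Finset.sum_smul, hsum Q (frontier_subset_closure hQ), one_smul]

end IsLipschitzDomain

/-! ### Unique differentiability on the closure. -/

lemma convex_downward_cone (K : ℝ) (hK : 0 ≤ K) (z : E3) :
    Convex ℝ {y : E3 | y 2 + K * ‖horizontal y - horizontal z‖ < z 2} := by
  intro y hy w hw a b ha hb hab
  simp only [mem_ofPred_eq] at hy hw ⊢
  have h1 : horizontal (a • y + b • w) - horizontal z =
      a • (horizontal y - horizontal z) + b • (horizontal w - horizontal z) := by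
    ext i; fin_cases i <;> simp <;> linear_combination (z _) * hab
  have h2 : ‖horizontal (a • y + b • w) - horizontal z‖ ≤
      a * ‖horizontal y - horizontal z‖ + b * ‖horizontal w - horizontal z‖ := by
    rw [h1]
    refine (norm_add_le _ _).trans ?_
    rw [norm_smul, norm_smul, Real.norm_of_nonneg ha, Real.norm_of_nonneg hb]
  have h3 : (a • y + b • w) 2 = a * y 2 + b * w 2 := by simp
  rw [h3]
  have h4 := mul_le_mul_of_nonneg_left h2 hK
  have h5 : a * z 2 + b * z 2 = z 2 := by rw [← add_mul, hab, one_mul]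
  -- Strictness comes from whichever weight is positive, so `a = 0` is separate.
  rcases ha.eq_or_lt with rfl | ha'
  · have : b = 1 := by linarith
    subst this; linarith
  · linarith [mul_lt_mul_of_pos_left hy ha', mul_le_mul_of_nonneg_left hw.le hb]

/-- The open cone of slope `K` hanging from `e p` stays below the `K`-Lipschitz graph. Cut with the
ball, it gives a convex open subset of `Ω` with `p` in its closure, which determines derivatives at
`p`. This is what makes one-sided boundary derivatives well defined. -/
lemma IsGraphChart.uniqueDiffWithinAt {Ω : Set E3} {p : E3} {r : ℝ} {e : E3 ≃ₗᵢ[ℝ] E3}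
    {g : E2 → ℝ} {K : ℝ≥0} (h : IsGraphChart Ω p r e g K) (hr : 0 < r) (hp : p ∈ closure Ω) :
    UniqueDiffWithinAt ℝ (closure Ω) p := by
  set C : Set E3 := {y : E3 | y 2 + K * ‖horizontal y - horizontal (e p)‖ < (e p) 2}
  have hCo : IsOpen C := isOpen_lt ((by fun_prop : Continuous fun y : E3 => y 2).add
    (continuous_const.mul (continuous_horizontal.sub continuous_const).norm)) continuous_const
  have hpg := (h.mem_closure_iff (mem_ball_self hr)).1 hp
  set S := e ⁻¹' C ∩ ball p r
  have hSo : IsOpen S := (hCo.preimage e.continuous).inter isOpen_ball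
  have hSΩ : S ⊆ Ω := fun x hx => by
    refine (h.mem_iff x hx.2).2 ?_
    have h1 : (e x) 2 + K * ‖horizontal (e x) - horizontal (e p)‖ < (e p) 2 := hx.1
    have h2 := h.lipschitz.dist_le_mul (horizontal (e x)) (horizontal (e p))
    rw [Real.dist_eq, dist_eq_norm] at h2
    have h3 := (abs_le.1 h2).1
    change (e x) 2 < g (horizontal (e x))
    linarith
  have hconv : Convex ℝ S :=
    ((convex_downward_cone K K.2 (e p)).linear_preimage e.toLinearEquiv.toLinearMap).inter
      (convex_ball p r)
  have hpS : p ∈ closure S := by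
    have hc : Continuous fun s : ℝ => e.symm (liftCLM (horizontal (e p), (e p) 2 - s)) :=
      e.symm.continuous.comp (by fun_prop)
    have ht := (hc.tendsto 0).mono_left (nhdsWithin_le_nhds (s := Ioi 0))
    simp only [sub_zero, liftCLM_apply, liftPoint_horizontal, e.symm_apply_apply] at ht
    refine mem_closure_of_tendsto ht ?_
    filter_upwards [eventually_mem_nhdsWithin, ht (ball_mem_nhds p hr)] with s hs hsb
    refine ⟨?_, hsb⟩
    have hs' : 0 < s := hs
    simp [C, hs']
  have hne : (interior S).Nonempty := by
    rw [hSo.interior_eq]; exact closure_nonempty_iff.1 ⟨p, hpS⟩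
  exact (uniqueDiffWithinAt_convex hconv hne hpS).mono (hSΩ.trans subset_closure)

lemma IsLipschitzDomain.uniqueDiffOn_closure {Ω : Set E3} (hΩ : IsLipschitzDomain Ω) :
    UniqueDiffOn ℝ (closure Ω) := fun p hp => by
  obtain ⟨r, hr, e, g, K, h⟩ := hΩ.exists_graphChart hp
  exact h.uniqueDiffWithinAt hr hp

/-! ### Green's second identity for smooth kernels. -/

lemma divergence_sub {V W : E3 → E3} {y : E3} (hV : DifferentiableAt ℝ V y)
    (hW : DifferentiableAt ℝ W y) :
    divergence (fun z => V z - W z) y = divergence V y - divergence W y := by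
  rw [divergence, fderiv_fun_sub hV hW]
  simp [divergence]

/-- The vector representing a linear form on `ℝ³`. -/
def dualVector : (E3 →L[ℝ] ℝ) →L[ℝ] E3 :=
  LinearMap.toContinuousLinearMap
    { toFun := fun L => (toDual ℝ E3).symm L
      map_add' := fun L M => map_add _ L M
      map_smul' := fun c L => by simp }

lemma inner_dualVector (L : E3 →L[ℝ] ℝ) (v : E3) : inner ℝ (dualVector L) v = L v :=
  toDual_symm_apply (𝕜 := ℝ)

lemma dualVector_coord (L : E3 →L[ℝ] ℝ) (i : Fin 3) :
    dualVector L i = L (EuclideanSpace.single i 1) := by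
  rw [← inner_dualVector, EuclideanSpace.inner_single_right]; simp

lemma laplacian_eq_sum_fderiv (h : E3 → ℝ) (y : E3) :
    (Δ h) y = ∑ i : Fin 3, fderiv ℝ (fderiv ℝ h) y (EuclideanSpace.single i 1)
      (EuclideanSpace.single i 1) := by
  rw [laplacian_eq_iteratedFDeriv_orthonormalBasis h (EuclideanSpace.basisFun (Fin 3) ℝ)]
  simp [iteratedFDeriv_two_apply]

lemma divergence_gradient {h : E3 → ℝ} {y : E3} (hh : ContDiffAt ℝ 2 h y) :
    divergence (fun z => dualVector (fderiv ℝ h z)) y = (Δ h) y := by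
  have hd : DifferentiableAt ℝ (fderiv ℝ h) y :=
    (hh.fderiv_right (m := 1) (by norm_num)).differentiableAt one_ne_zero
  have h1 : fderiv ℝ (fun z => dualVector (fderiv ℝ h z)) y =
      dualVector.comp (fderiv ℝ (fderiv ℝ h) y) :=
    (dualVector.hasFDerivAt.comp y hd.hasFDerivAt).fderiv
  rw [divergence_eq_sum, laplacian_eq_sum_fderiv, h1]
  simp [dualVector_coord]

/-- Green's second identity on a Lipschitz domain, between a smooth function and a function which is
harmonic in the domain and `C¹` up to the boundary. -/
theorem IsLipschitzDomain.integral_laplacian_mul {Ω : Set E3} (hΩ : IsLipschitzDomain Ω)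
    {f h : E3 → ℝ} (hf : ContDiffOn ℝ 1 f (closure Ω)) (hharm : HarmonicOnNhd f Ω)
    (hh : ContDiff ℝ 2 h) :
    ∫ y in Ω, (Δ h) y * f y = ∫ Q, (fderiv ℝ h Q (exteriorNormal Ω Q) * f Q -
      h Q * fderivWithin ℝ f (closure Ω) Q (exteriorNormal Ω Q)) ∂(surfaceMeasure Ω) := by
  set G : E3 → E3 := fun y => dualVector (fderiv ℝ h y)
  -- The field is `f∇h - h∇f`. The gradient of `f` is taken within the closure, so that it is
  -- continuous up to the boundary; inside `Ω` it is the usual one.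
  set G' : E3 → E3 := fun y => dualVector (fderivWithin ℝ f (closure Ω) y)
  set V : E3 → E3 := fun y => f y • G y - h y • G' y
  have hGd : ContDiff ℝ 1 G := dualVector.contDiff.comp (hh.fderiv_right (by norm_num))
  have hVc : ContinuousOn V (closure Ω) :=
    (hf.continuousOn.smul hGd.continuous.continuousOn).sub (hh.continuous.continuousOn.smul
      (dualVector.continuous.comp_continuousOn
        (hf.continuousOn_fderivWithin hΩ.uniqueDiffOn_closure le_rfl)))
  have hG' : ∀ y ∈ Ω, G' =ᶠ[𝓝 y] fun z => dualVector (fderiv ℝ f z) := fun y hy => by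
    filter_upwards [hΩ.isOpen.mem_nhds hy] with z hz
    simp only [G']
    rw [fderivWithin_of_mem_nhds (mem_of_superset (hΩ.isOpen.mem_nhds hz) subset_closure)]
  have hG'd : ∀ y ∈ Ω, ContDiffAt ℝ 1 G' y := fun y hy => by
    have : ContDiffAt ℝ 1 (fun z => dualVector (fderiv ℝ f z)) y :=
      dualVector.contDiff.contDiffAt.comp y ((hharm y hy).1.fderiv_right (by norm_num))
    exact this.congr_of_eventuallyEq (hG' y hy)
  have hfd : ∀ y ∈ Ω, ContDiffAt ℝ 1 f y := fun y hy => (hharm y hy).1.of_le (by norm_num)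
  have hV : ContDiffOn ℝ 1 V Ω := fun y hy =>
    (((hfd y hy).smul hGd.contDiffAt).sub
      ((hh.of_le (by norm_num)).contDiffAt.smul (hG'd y hy))).contDiffWithinAt
  have hdiv : ∀ y ∈ Ω, divergence V y = (Δ h) y * f y := fun y hy => by
    have d1 := (hfd y hy).differentiableAt one_ne_zero
    have d2 := hGd.differentiable one_ne_zero y
    have d3 := hh.differentiable two_ne_zero y
    have d4 := (hG'd y hy).differentiableAt one_ne_zero
    rw [divergence_sub (d1.fun_smul d2) (d3.fun_smul d4), divergence_smul d1 d2, divergence_smul d3 d4,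
      divergence_gradient hh.contDiffAt, divergence_congr (hG' y hy),
      divergence_gradient (hharm y hy).1, (hharm y hy).2.eq_of_nhds, (hG' y hy).eq_of_nhds,
      ← inner_dualVector (fderiv ℝ f y), ← inner_dualVector (fderiv ℝ h y), real_inner_comm]
    simp only [G, Pi.zero_apply]
    ring
  have hlap : Continuous (Δ h) := by
    have : Continuous fun y => ∑ i : Fin 3, fderiv ℝ (fderiv ℝ h) y (EuclideanSpace.single i 1)
        (EuclideanSpace.single i 1) := by
      have h1 : ContDiff ℝ 1 (fderiv ℝ h) := hh.fderiv_right (by norm_num)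
      have h2 := h1.continuous_fderiv one_ne_zero
      fun_prop
    convert this using 1
    exact funext fun y => laplacian_eq_sum_fderiv h y
  have hint : IntegrableOn (divergence V) Ω := by
    refine IntegrableOn.congr_fun ?_ (fun y hy => (hdiv y hy).symm) hΩ.isOpen.measurableSet
    exact (ContinuousOn.integrableOn_compact hΩ.isCompact_closure
      (hlap.continuousOn.mul hf.continuousOn)).mono_set subset_closure
  rw [← setIntegral_congr_fun hΩ.isOpen.measurableSet hdiv, hΩ.integral_divergence hVc hV hint]
  congr 1
  funext Q
  simp only [V, G, G', inner_sub_left, inner_smul_left, inner_dualVector, conj_trivial]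
  ring

/-! ### The regularised kernel and its derivatives. -/

/-- The regularised distance `√(|Q - P|² + ε²)`. -/
def regRadius (ε : ℝ) (P Q : E3) : ℝ := √(‖Q - P‖ ^ 2 + ε ^ 2)

/-- The kernel `𝓗_{kj}` with the distance regularised. -/
def regKernelH (μ : ℝ) (k j : Fin 3) (ε : ℝ) (P Q : E3) : ℝ :=
  1 / (32 * Real.pi * μ ^ 2) * (3 * regRadius ε P Q * (if k = j then 1 else 0) -
    (Q - P) k * (Q - P) j / regRadius ε P Q)

/-- The derivative of `regKernelH` at `Q` in the direction `v`. -/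
def regKernelHDeriv (μ : ℝ) (k j : Fin 3) (ε : ℝ) (P Q v : E3) : ℝ :=
  1 / (32 * Real.pi * μ ^ 2) * (3 * (inner ℝ (Q - P) v / regRadius ε P Q) * (if k = j then 1 else 0) -
    (v k * (Q - P) j + (Q - P) k * v j) / regRadius ε P Q +
    (Q - P) k * (Q - P) j * inner ℝ (Q - P) v / regRadius ε P Q ^ 3)

/-- The Laplacian of `regKernelH`. -/
def regKernelHLaplacian (μ : ℝ) (k j : Fin 3) (ε : ℝ) (P Q : E3) : ℝ :=
  1 / (32 * Real.pi * μ ^ 2) * ((4 / regRadius ε P Q + 3 * ε ^ 2 / regRadius ε P Q ^ 3) *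
    (if k = j then 1 else 0) + (4 / regRadius ε P Q ^ 3 + 3 * ε ^ 2 / regRadius ε P Q ^ 5) *
    ((Q - P) k * (Q - P) j))

lemma regRadius_zero (P Q : E3) : regRadius 0 P Q = ‖Q - P‖ := by
  simp [regRadius]

lemma regKernelH_zero (μ : ℝ) (k j : Fin 3) (P Q : E3) :
    regKernelH μ k j 0 P Q = kernelH μ k j Q P := by
  rw [regKernelH, kernelH, regRadius_zero]

lemma regRadius_sq (ε : ℝ) (P Q : E3) : regRadius ε P Q ^ 2 = ‖Q - P‖ ^ 2 + ε ^ 2 :=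
  Real.sq_sqrt (by positivity)

lemma regRadius_nonneg (ε : ℝ) (P Q : E3) : 0 ≤ regRadius ε P Q := Real.sqrt_nonneg _

lemma norm_sub_le_regRadius (ε : ℝ) (P Q : E3) : ‖Q - P‖ ≤ regRadius ε P Q :=
  Real.le_sqrt_of_sq_le (by nlinarith [sq_nonneg ε])

lemma abs_le_regRadius (ε : ℝ) (P Q : E3) : |ε| ≤ regRadius ε P Q :=
  Real.le_sqrt_of_sq_le (by rw [sq_abs]; nlinarith [sq_nonneg ‖Q - P‖])

lemma regRadius_pos_of_eps {ε : ℝ} (hε : ε ≠ 0) (P Q : E3) : 0 < regRadius ε P Q :=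
  (abs_pos.2 hε).trans_le (abs_le_regRadius ε P Q)

lemma regRadius_pos_of_ne (ε : ℝ) {P Q : E3} (h : Q ≠ P) : 0 < regRadius ε P Q :=
  (norm_pos_iff.2 (sub_ne_zero.2 h)).trans_le (norm_sub_le_regRadius ε P Q)

lemma continuous_regRadius : Continuous fun x : ℝ × E3 × E3 => regRadius x.1 x.2.1 x.2.2 := by
  unfold regRadius; fun_prop

lemma contDiffAt_regRadius {ε : ℝ} {P Q : E3} (h : 0 < regRadius ε P Q) :
    ContDiffAt ℝ 2 (regRadius ε P) Q := by
  have h1 : ContDiffAt ℝ 2 (fun Q : E3 => ‖Q - P‖ ^ 2 + ε ^ 2) Q :=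
    ((contDiff_id.sub contDiff_const).norm_sq ℝ).contDiffAt.add contDiffAt_const
  exact h1.sqrt (by rw [← regRadius_sq]; positivity)

lemma contDiffAt_regKernelH {μ : ℝ} {k j : Fin 3} {ε : ℝ} {P Q : E3} (h : 0 < regRadius ε P Q) :
    ContDiffAt ℝ 2 (regKernelH μ k j ε P) Q := by
  have hρ := contDiffAt_regRadius h
  have hc : ∀ i : Fin 3, ContDiffAt ℝ 2 (fun Q : E3 => (Q - P) i) Q := fun i => by fun_prop
  exact contDiffAt_const.mul (((contDiffAt_const.mul hρ).mul contDiffAt_const).sub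
    (((hc k).mul (hc j)).div hρ h.ne'))

lemma hasDerivAt_regRadius_line {ε : ℝ} {P Q : E3} (h : 0 < regRadius ε P Q) (v : E3) :
    HasDerivAt (fun t : ℝ => regRadius ε P (Q + t • v))
      (inner ℝ (Q - P) v / regRadius ε P Q) 0 := by
  have h0 : HasDerivAt (fun t : ℝ => Q + t • v - P) v 0 := by
    simpa using (((hasDerivAt_id (0 : ℝ)).smul_const v).const_add Q).sub_const P
  have h1 := (h0.norm_sq.add_const (ε ^ 2)).sqrt (by
    simp only [zero_smul, add_zero]; rw [← regRadius_sq]; positivity)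
  refine h1.congr_deriv ?_
  have : √(‖Q - P‖ ^ 2 + ε ^ 2) = regRadius ε P Q := rfl
  simp only [zero_smul, add_zero, this]
  field_simp

lemma hasDerivAt_sub_coord_line (P Q v : E3) (i : Fin 3) :
    HasDerivAt (fun t : ℝ => (Q + t • v - P) i) (v i) 0 := by
  have : HasDerivAt (fun t : ℝ => Q i + t * v i - P i) (v i) 0 := by
    simpa using (((hasDerivAt_id (0 : ℝ)).mul_const (v i)).const_add (Q i)).sub_const (P i)
  exact this

lemma hasDerivAt_inner_line (P Q v : E3) :
    HasDerivAt (fun t : ℝ => inner ℝ (Q + t • v - P) v) (‖v‖ ^ 2) 0 := by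
  have h0 : HasDerivAt (fun t : ℝ => Q + t • v - P) v 0 := by
    simpa using (((hasDerivAt_id (0 : ℝ)).smul_const v).const_add Q).sub_const P
  have := h0.inner ℝ (hasDerivAt_const (0 : ℝ) v)
  simpa using this

lemma fderiv_regKernelH {μ : ℝ} {k j : Fin 3} {ε : ℝ} {P Q : E3} (h : 0 < regRadius ε P Q)
    (v : E3) : fderiv ℝ (regKernelH μ k j ε P) Q v = regKernelHDeriv μ k j ε P Q v := by
  have hd : DifferentiableAt ℝ (regKernelH μ k j ε P) Q :=
    (contDiffAt_regKernelH h).differentiableAt two_ne_zero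
  rw [← hd.lineDeriv_eq_fderiv]
  have hρ := hasDerivAt_regRadius_line h v
  have hk := hasDerivAt_sub_coord_line P Q v k
  have hj := hasDerivAt_sub_coord_line P Q v j
  have hne : regRadius ε P (Q + (0 : ℝ) • v) ≠ 0 := by simpa using h.ne'
  have H := (((hρ.const_mul 3).mul_const (if k = j then (1 : ℝ) else 0)).sub
    ((hk.mul hj).div hρ hne)).const_mul (1 / (32 * Real.pi * μ ^ 2))
  refine (HasLineDerivAt.lineDeriv (f := regKernelH μ k j ε P) H).trans ?_
  rw [regKernelHDeriv]
  simp only [zero_smul, add_zero, Pi.mul_apply]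
  congr 1
  field_simp
  ring

/-- The second derivative of `regKernelH` in a direction `v`. -/
lemma hasDerivAt_regKernelHDeriv_line {μ : ℝ} {k j : Fin 3} {ε : ℝ} {P Q : E3}
    (h : 0 < regRadius ε P Q) (v : E3) :
    HasDerivAt (fun t : ℝ => regKernelHDeriv μ k j ε P (Q + t • v) v)
      (1 / (32 * Real.pi * μ ^ 2) * (3 * (‖v‖ ^ 2 / regRadius ε P Q -
        inner ℝ (Q - P) v ^ 2 / regRadius ε P Q ^ 3) * (if k = j then 1 else 0) -
        2 * (v k * v j) / regRadius ε P Q +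
        2 * ((v k * (Q - P) j + (Q - P) k * v j) * inner ℝ (Q - P) v) / regRadius ε P Q ^ 3 +
        (Q - P) k * (Q - P) j * ‖v‖ ^ 2 / regRadius ε P Q ^ 3 -
        3 * ((Q - P) k * (Q - P) j) * inner ℝ (Q - P) v ^ 2 / regRadius ε P Q ^ 5)) 0 := by
  have hρ := hasDerivAt_regRadius_line h v
  have hk := hasDerivAt_sub_coord_line P Q v k
  have hj := hasDerivAt_sub_coord_line P Q v j
  have hs := hasDerivAt_inner_line P Q v
  have hne : regRadius ε P (Q + (0 : ℝ) • v) ≠ 0 := by simpa using h.ne'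
  have H := ((((hs.fun_div hρ hne).const_mul 3).mul_const (if k = j then (1 : ℝ) else 0)).fun_sub
    (((hj.const_mul (v k)).fun_add (hk.mul_const (v j))).fun_div hρ hne)).fun_add
    (((hk.fun_mul hj).fun_mul hs).fun_div (hρ.fun_pow 3) (pow_ne_zero 3 hne)) |>.const_mul
      (1 / (32 * Real.pi * μ ^ 2))
  refine H.congr_deriv ?_
  simp only [zero_smul, add_zero]
  congr 1
  field_simp
  ring

lemma laplacian_regKernelH {μ : ℝ} {k j : Fin 3} {ε : ℝ} {P Q : E3} (h : 0 < regRadius ε P Q) :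
    (Δ (regKernelH μ k j ε P)) Q = regKernelHLaplacian μ k j ε P Q := by
  have hd : DifferentiableAt ℝ (fderiv ℝ (regKernelH μ k j ε P)) Q :=
    ((contDiffAt_regKernelH h).fderiv_right (m := 1) (by norm_num)).differentiableAt one_ne_zero
  have hpos : ∀ᶠ y in 𝓝 Q, 0 < regRadius ε P y :=
    (contDiffAt_regRadius h).continuousAt.eventually_const_lt h
  -- The Laplacian needs only pure second derivatives, so differentiating twice along a line is
  -- enough.
  have key : ∀ v L, HasDerivAt (fun t : ℝ => regKernelHDeriv μ k j ε P (Q + t • v) v) L 0 →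
      fderiv ℝ (fderiv ℝ (regKernelH μ k j ε P)) Q v v = L := fun v L hL => by
    have h1 : fderiv ℝ (fderiv ℝ (regKernelH μ k j ε P)) Q v v =
        fderiv ℝ (fun y => fderiv ℝ (regKernelH μ k j ε P) y v) Q v := by
      rw [fderiv_clm_apply hd (by fun_prop)]; simp
    have hd2 : DifferentiableAt ℝ (fun y => fderiv ℝ (regKernelH μ k j ε P) y v) Q :=
      hd.clm_apply (by fun_prop)
    have h2 : (fun y => fderiv ℝ (regKernelH μ k j ε P) y v) =ᶠ[𝓝 Q]
        fun y => regKernelHDeriv μ k j ε P y v := by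
      filter_upwards [hpos] with y hy using fderiv_regKernelH hy v
    rw [h1, ← hd2.lineDeriv_eq_fderiv, h2.lineDeriv_eq]
    exact HasLineDerivAt.lineDeriv (f := fun y => regKernelHDeriv μ k j ε P y v) hL
  rw [laplacian_eq_sum_fderiv]
  simp only [fun v => key v _ (hasDerivAt_regKernelHDeriv_line h v)]
  have hsq := regRadius_sq ε P Q
  rw [EuclideanSpace.real_norm_sq_eq, Fin.sum_univ_three] at hsq
  -- With `ε²` eliminated, the claim is a rational identity in the regularised radius and the
  -- coordinates of `Q - P`.
  have hε : ε ^ 2 = regRadius ε P Q ^ 2 - ((Q - P) 0 ^ 2 + (Q - P) 1 ^ 2 + (Q - P) 2 ^ 2) := by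
    linarith
  rw [regKernelHLaplacian, ← Finset.mul_sum, Fin.sum_univ_three, hε]
  congr 1
  have hne := h.ne'
  simp only [EuclideanSpace.inner_single_right, PiLp.norm_single, norm_one, one_pow,
    conj_trivial, one_mul]
  generalize (Q - P) = R
  fin_cases k <;> fin_cases j <;> simp <;> field_simp <;> ring

/-! ### Bounds uniform in `ε`, limits and integrability. -/

lemma abs_sub_coord_le_regRadius (ε : ℝ) (P Q : E3) (i : Fin 3) :
    |(Q - P) i| ≤ regRadius ε P Q :=
  (PiLp.norm_apply_le (Q - P) i).trans (norm_sub_le_regRadius ε P Q)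

lemma abs_ite_one_zero_le (p : Prop) [Decidable p] : |if p then (1 : ℝ) else 0| ≤ 1 := by
  split_ifs <;> simp

lemma abs_div_le_of_abs_le {a b ρ : ℝ} (hρ : 0 < ρ) (h : |a| ≤ b * ρ) : |a / ρ| ≤ b := by
  rw [abs_div, abs_of_pos hρ]; exact (div_le_iff₀ hρ).2 h

lemma abs_coord_mul_coord_le (ε : ℝ) (P Q : E3) (k j : Fin 3) :
    |(Q - P) k * (Q - P) j| ≤ regRadius ε P Q ^ 2 := by
  rw [abs_mul, sq]
  exact mul_le_mul (abs_sub_coord_le_regRadius ε P Q k) (abs_sub_coord_le_regRadius ε P Q j)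
    (abs_nonneg _) (regRadius_nonneg ε P Q)

lemma abs_regKernelH_le (μ : ℝ) (k j : Fin 3) {ε : ℝ} {P Q : E3} (h : 0 < regRadius ε P Q) :
    |regKernelH μ k j ε P Q| ≤ 1 / (32 * Real.pi * μ ^ 2) * (4 * regRadius ε P Q) := by
  have hc : 0 ≤ 1 / (32 * Real.pi * μ ^ 2) := by positivity
  rw [regKernelH, abs_mul, abs_of_nonneg hc]
  refine mul_le_mul_of_nonneg_left ?_ hc
  have h1 : |3 * regRadius ε P Q * (if k = j then (1 : ℝ) else 0)| ≤ 3 * regRadius ε P Q := by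
    rw [abs_mul, abs_of_pos (by positivity : 0 < 3 * regRadius ε P Q)]
    exact mul_le_of_le_one_right (by positivity) (abs_ite_one_zero_le _)
  have h2 : |(Q - P) k * (Q - P) j / regRadius ε P Q| ≤ regRadius ε P Q :=
    abs_div_le_of_abs_le h ((abs_coord_mul_coord_le ε P Q k j).trans (sq _).le)
  exact (abs_sub _ _).trans (by linarith)

lemma abs_regKernelHDeriv_le (μ : ℝ) (k j : Fin 3) {ε : ℝ} {P Q : E3} (h : 0 < regRadius ε P Q)
    (v : E3) :
    |regKernelHDeriv μ k j ε P Q v| ≤ 1 / (32 * Real.pi * μ ^ 2) * (6 * ‖v‖) := by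
  have hc : 0 ≤ 1 / (32 * Real.pi * μ ^ 2) := by positivity
  have hi : |inner ℝ (Q - P) v| ≤ ‖v‖ * regRadius ε P Q := by
    refine (abs_real_inner_le_norm _ _).trans ?_
    rw [mul_comm]
    exact mul_le_mul_of_nonneg_left (norm_sub_le_regRadius ε P Q) (norm_nonneg v)
  have hv : ∀ i, |v i| ≤ ‖v‖ := fun i => PiLp.norm_apply_le v i
  have hR := abs_sub_coord_le_regRadius ε P Q
  rw [regKernelHDeriv, abs_mul, abs_of_nonneg hc]
  refine mul_le_mul_of_nonneg_left ?_ hc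
  have h1 : |3 * (inner ℝ (Q - P) v / regRadius ε P Q) * (if k = j then (1 : ℝ) else 0)| ≤
      3 * ‖v‖ := by
    rw [abs_mul, abs_mul, abs_of_pos (by norm_num : (0 : ℝ) < 3)]
    exact (mul_le_of_le_one_right (by positivity) (abs_ite_one_zero_le _)).trans
      (mul_le_mul_of_nonneg_left (abs_div_le_of_abs_le h hi) (by norm_num))
  have h2 : |(v k * (Q - P) j + (Q - P) k * v j) / regRadius ε P Q| ≤ 2 * ‖v‖ := by
    refine abs_div_le_of_abs_le h ((abs_add_le _ _).trans ?_)
    rw [abs_mul, abs_mul]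
    have := mul_le_mul (hv k) (hR j) (abs_nonneg _) (norm_nonneg v)
    have := mul_le_mul (hR k) (hv j) (abs_nonneg _) h.le
    linarith
  have h3 : |(Q - P) k * (Q - P) j * inner ℝ (Q - P) v / regRadius ε P Q ^ 3| ≤ ‖v‖ := by
    refine abs_div_le_of_abs_le (pow_pos h 3) ?_
    rw [abs_mul]
    refine (mul_le_mul (abs_coord_mul_coord_le ε P Q k j) hi (abs_nonneg _)
      (by positivity)).trans (le_of_eq (by ring))
  refine (abs_add_le _ _).trans ?_
  have := abs_sub (3 * (inner ℝ (Q - P) v / regRadius ε P Q) * (if k = j then (1 : ℝ) else 0))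
    ((v k * (Q - P) j + (Q - P) k * v j) / regRadius ε P Q)
  linarith

/-- Since `ε²` and `|R_k R_j|` are at most the squared regularised radius, each of the two terms is
at most `4 + 3 = 7` over that radius. The bound does not involve `ε` and serves as the dominating
function in the volume. -/
lemma abs_regKernelHLaplacian_le (μ : ℝ) (k j : Fin 3) (ε : ℝ) {P Q : E3} (hQ : Q ≠ P) :
    |regKernelHLaplacian μ k j ε P Q| ≤ 1 / (32 * Real.pi * μ ^ 2) * (14 * ‖Q - P‖⁻¹) := by
  have hc : 0 ≤ 1 / (32 * Real.pi * μ ^ 2) := by positivity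
  have h := regRadius_pos_of_ne ε hQ
  have hε : ε ^ 2 ≤ regRadius ε P Q ^ 2 := by
    rw [regRadius_sq]; nlinarith [sq_nonneg ‖Q - P‖]
  have hinv : (regRadius ε P Q)⁻¹ ≤ ‖Q - P‖⁻¹ :=
    inv_anti₀ (norm_pos_iff.2 (sub_ne_zero.2 hQ)) (norm_sub_le_regRadius ε P Q)
  have hRR := abs_coord_mul_coord_le ε P Q k j
  rw [regKernelHLaplacian, abs_mul, abs_of_nonneg hc]
  refine mul_le_mul_of_nonneg_left ?_ hc
  set ρ := regRadius ε P Q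
  have h1 : |(4 / ρ + 3 * ε ^ 2 / ρ ^ 3) * (if k = j then (1 : ℝ) else 0)| ≤ 7 * ρ⁻¹ := by
    rw [abs_mul, abs_of_nonneg (by positivity)]
    refine (mul_le_of_le_one_right (by positivity) (abs_ite_one_zero_le _)).trans ?_
    calc 4 / ρ + 3 * ε ^ 2 / ρ ^ 3 ≤ 4 / ρ + 3 * ρ ^ 2 / ρ ^ 3 := by gcongr
      _ = 7 * ρ⁻¹ := by field_simp; norm_num
  have h2 : |(4 / ρ ^ 3 + 3 * ε ^ 2 / ρ ^ 5) * ((Q - P) k * (Q - P) j)| ≤ 7 * ρ⁻¹ := by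
    rw [abs_mul, abs_of_nonneg (by positivity)]
    calc (4 / ρ ^ 3 + 3 * ε ^ 2 / ρ ^ 5) * |(Q - P) k * (Q - P) j|
        ≤ (4 / ρ ^ 3 + 3 * ρ ^ 2 / ρ ^ 5) * ρ ^ 2 := by gcongr
      _ = 7 * ρ⁻¹ := by field_simp; norm_num
  refine (abs_add_le _ _).trans ?_
  linarith

lemma tendsto_regRadius {ε : ℕ → ℝ} (hε : Tendsto ε atTop (𝓝 0)) (P Q : E3) :
    Tendsto (fun n => regRadius (ε n) P Q) atTop (𝓝 (regRadius 0 P Q)) :=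
  (continuous_regRadius.comp (by fun_prop : Continuous fun e : ℝ => (e, P, Q))).continuousAt.tendsto.comp hε

section limits

variable {ε : ℕ → ℝ} (hε : Tendsto ε atTop (𝓝 0)) {P Q : E3} (hQ : Q ≠ P) (μ : ℝ) (k j : Fin 3)
include hε hQ

lemma tendsto_regKernelH :
    Tendsto (fun n => regKernelH μ k j (ε n) P Q) atTop (𝓝 (regKernelH μ k j 0 P Q)) := by
  have hρ := tendsto_regRadius hε P Q
  have h0 : regRadius 0 P Q ≠ 0 := (regRadius_pos_of_ne 0 hQ).ne'
  exact (((hρ.const_mul 3).mul_const _).sub (tendsto_const_nhds.div hρ h0)).const_mul _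

lemma tendsto_regKernelHDeriv (v : E3) :
    Tendsto (fun n => regKernelHDeriv μ k j (ε n) P Q v) atTop
      (𝓝 (regKernelHDeriv μ k j 0 P Q v)) := by
  have hρ := tendsto_regRadius hε P Q
  have h0 : regRadius 0 P Q ≠ 0 := (regRadius_pos_of_ne 0 hQ).ne'
  exact (((((tendsto_const_nhds.div hρ h0).const_mul 3).mul_const _).sub
    (tendsto_const_nhds.div hρ h0)).add
      (tendsto_const_nhds.div (hρ.pow 3) (pow_ne_zero 3 h0))).const_mul _

lemma tendsto_regKernelHLaplacian :
    Tendsto (fun n => regKernelHLaplacian μ k j (ε n) P Q) atTop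
      (𝓝 (regKernelHLaplacian μ k j 0 P Q)) := by
  have hρ := tendsto_regRadius hε P Q
  have h0 : regRadius 0 P Q ≠ 0 := (regRadius_pos_of_ne 0 hQ).ne'
  exact ((((tendsto_const_nhds.div hρ h0).add
    (((hε.pow 2).const_mul 3).div (hρ.pow 3) (pow_ne_zero 3 h0))).mul_const _).add
    (((tendsto_const_nhds.div (hρ.pow 3) (pow_ne_zero 3 h0)).add
    (((hε.pow 2).const_mul 3).div (hρ.pow 5) (pow_ne_zero 5 h0))).mul_const _)).const_mul _

end limits

lemma measurable_regRadius (ε : ℝ) (P : E3) : Measurable (regRadius ε P) := by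
  unfold regRadius; fun_prop

lemma measurable_regKernelH (μ : ℝ) (k j : Fin 3) (ε : ℝ) (P : E3) :
    Measurable (regKernelH μ k j ε P) := by
  have := measurable_regRadius ε P
  unfold regKernelH; fun_prop

lemma measurable_regKernelHLaplacian (μ : ℝ) (k j : Fin 3) (ε : ℝ) (P : E3) :
    Measurable (regKernelHLaplacian μ k j ε P) := by
  have := measurable_regRadius ε P
  unfold regKernelHLaplacian; fun_prop

/-- In polar coordinates the Jacobian `y²` turns `y⁻¹` into the integrable function `y`. -/
lemma integrableOn_inv_norm_sub {s : Set E3} (hs : Bornology.IsBounded s) (P : E3) :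
    IntegrableOn (fun Q => ‖Q - P‖⁻¹) s := by
  obtain ⟨r, hr⟩ := hs.subset_ball P
  have h1 : IntegrableOn (fun x : E3 => ‖x‖⁻¹) (ball 0 r) := by
    refine (integrableOn_fun_norm_addHaar volume (f := fun y => y⁻¹)).2 ?_
    rw [finrank_euclideanSpace_fin]
    have h2 : IntegrableOn (fun y : ℝ => y) (Ioo 0 r) :=
      (continuous_id.integrableOn_Icc (a := 0) (b := r)).mono_set Ioo_subset_Icc_self
    refine h2.congr_fun (fun y hy => ?_) measurableSet_Ioo
    have : y ≠ 0 := hy.1.ne'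
    simp only [smul_eq_mul]
    field_simp
  have h3 := ((measurePreserving_sub_right (volume : Measure E3) P).integrableOn_comp_preimage
    (Homeomorph.subRight P).measurableEmbedding).2 h1
  refine h3.mono_set (hr.trans fun Q hQ => ?_)
  rwa [mem_preimage, mem_ball_zero_iff, ← dist_eq_norm]

/-- Allows the pole to be ignored when it lies on the boundary. -/
instance nullSingletonClass_surfaceMeasure (Ω : Set E3) :
    NullSingletonClass (surfaceMeasure Ω) := by
  have : NullSingletonClass (μHE[2] : Measure E3) := ⟨fun x => by
    rw [Measure.euclideanHausdorffMeasure_def, Measure.smul_apply]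
    have := Measure.nullSingletonClass_hausdorff E3 (d := ((2 : ℕ) : ℝ)) (by norm_num)
    rw [measure_singleton, smul_zero]⟩
  unfold surfaceMeasure
  infer_instance

/-! ### Green's second identity for the singular kernel. -/

namespace IsLipschitzDomain

variable {Ω : Set E3} (hΩ : IsLipschitzDomain Ω)
include hΩ

lemma integrableOn_regKernelHLaplacian_mul {f : E3 → ℝ} (hf : ContinuousOn f (closure Ω))
    (μ : ℝ) (k j : Fin 3) (ε : ℝ) (P : E3) :
    IntegrableOn (fun Q => regKernelHLaplacian μ k j ε P Q * f Q) Ω := by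
  obtain ⟨C, hC⟩ := hΩ.isCompact_closure.exists_bound_of_continuousOn hf
  have h1 : IntegrableOn (fun Q => regKernelHLaplacian μ k j ε P Q) Ω := by
    refine Integrable.mono' (((integrableOn_inv_norm_sub hΩ.isBounded P).const_mul 14).const_mul
      (1 / (32 * Real.pi * μ ^ 2)))
      (measurable_regKernelHLaplacian μ k j ε P).aestronglyMeasurable
      ?_
    filter_upwards [measure_eq_zero_iff_ae_notMem.1
      (measure_singleton (μ := volume.restrict Ω) P)] with Q hQ
      using abs_regKernelHLaplacian_le μ k j ε hQ
  refine h1.mul_bdd (c := C) ((hf.mono subset_closure).aestronglyMeasurable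
    hΩ.isOpen.measurableSet) ?_
  filter_upwards [ae_restrict_mem hΩ.isOpen.measurableSet] with Q hQ
    using hC Q (subset_closure hQ)

/-- The boundary terms of Green's identity for the regularised kernel are dominated by
a constant, uniformly in `ε ∈ [0, 1]`. -/
lemma exists_bound_boundary {f : E3 → ℝ} (hf : ContDiffOn ℝ 1 f (closure Ω)) (μ : ℝ)
    (k j : Fin 3) (P : E3) : ∃ C, ∀ ε, 0 ≤ ε → ε ≤ 1 → ∀ Q ∈ frontier Ω, Q ≠ P →
      ‖fderiv ℝ (regKernelH μ k j ε P) Q (exteriorNormal Ω Q) * f Q -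
        regKernelH μ k j ε P Q * fderivWithin ℝ f (closure Ω) Q (exteriorNormal Ω Q)‖ ≤ C := by
  obtain ⟨C₁, hC₁⟩ := hΩ.isCompact_closure.exists_bound_of_continuousOn hf.continuousOn
  obtain ⟨C₂, hC₂⟩ := hΩ.isCompact_closure.exists_bound_of_continuousOn
    (hf.continuousOn_fderivWithin hΩ.uniqueDiffOn_closure le_rfl)
  obtain ⟨D, hD⟩ := hΩ.isCompact_closure.exists_bound_of_continuousOn
    (f := fun Q : E3 => Q - P) (by fun_prop)
  set c := 1 / (32 * Real.pi * μ ^ 2) with hc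
  have hc0 : 0 ≤ c := by positivity
  refine ⟨c * 6 * C₁ + c * (4 * (D + 1)) * C₂, fun ε h0 h1 Q hQ hQP => ?_⟩
  have hQ' := frontier_subset_closure hQ
  have hpos := regRadius_pos_of_ne ε hQP
  have hn := norm_exteriorNormal_le Ω Q
  have hρ : regRadius ε P Q ≤ D + 1 := by
    refine Real.sqrt_le_iff.2 ⟨by have := (norm_nonneg _).trans (hD Q hQ'); linarith, ?_⟩
    have := hD Q hQ'
    nlinarith [norm_nonneg (Q - P)]
  refine (norm_sub_le _ _).trans (add_le_add ?_ ?_)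
  · rw [norm_mul, fderiv_regKernelH hpos]
    refine mul_le_mul ((abs_regKernelHDeriv_le μ k j hpos _).trans ?_) (hC₁ Q hQ')
      (norm_nonneg _) (by positivity)
    exact mul_le_mul_of_nonneg_left (by linarith) hc0
  · rw [norm_mul]
    refine mul_le_mul ((abs_regKernelH_le μ k j hpos).trans ?_) ?_ (norm_nonneg _)
      (mul_nonneg hc0 (by linarith))
    · exact mul_le_mul_of_nonneg_left (by linarith) hc0
    · refine ((fderivWithin ℝ f (closure Ω) Q).le_opNorm _).trans ?_
      have := hC₂ Q hQ'
      nlinarith [norm_nonneg (fderivWithin ℝ f (closure Ω) Q), norm_nonneg (exteriorNormal Ω Q)]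

lemma aestronglyMeasurable_boundary {f : E3 → ℝ} (hf : ContDiffOn ℝ 1 f (closure Ω)) (μ : ℝ)
    (k j : Fin 3) (P : E3) (ε : ℝ) : AEStronglyMeasurable
      (fun Q => fderiv ℝ (regKernelH μ k j ε P) Q (exteriorNormal Ω Q) * f Q -
        regKernelH μ k j ε P Q * fderivWithin ℝ f (closure Ω) Q (exteriorNormal Ω Q))
      (surfaceMeasure Ω) := by
  have hn := hΩ.aestronglyMeasurable_exteriorNormal
  have happ : ∀ {A : E3 → E3 →L[ℝ] ℝ}, AEStronglyMeasurable A (surfaceMeasure Ω) →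
      AEStronglyMeasurable (fun Q => A Q (exteriorNormal Ω Q)) (surfaceMeasure Ω) := fun hA =>
    isBoundedBilinearMap_apply.continuous.comp_aestronglyMeasurable (hA.prodMk hn)
  refine ((happ (measurable_fderiv ℝ _).aestronglyMeasurable).mul
    hf.continuousOn.aestronglyMeasurable_surfaceMeasure).sub
      ((measurable_regKernelH μ k j ε P).aestronglyMeasurable.mul (happ ?_))
  exact (hf.continuousOn_fderivWithin hΩ.uniqueDiffOn_closure
    le_rfl).aestronglyMeasurable_surfaceMeasure

omit hΩ in
lemma ae_mem_frontier_and_ne (P : E3) :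
    ∀ᵐ Q ∂(surfaceMeasure Ω), Q ∈ frontier Ω ∧ Q ≠ P := by
  filter_upwards [ae_restrict_mem isClosed_frontier.measurableSet,
    (measure_eq_zero_iff_ae_notMem.1 (measure_singleton (μ := surfaceMeasure Ω) P))] with Q h1 h2
  exact ⟨h1, h2⟩

lemma integrable_boundary {f : E3 → ℝ} (hf : ContDiffOn ℝ 1 f (closure Ω)) (μ : ℝ)
    (k j : Fin 3) (P : E3) : Integrable
      (fun Q => fderiv ℝ (regKernelH μ k j 0 P) Q (exteriorNormal Ω Q) * f Q -
        regKernelH μ k j 0 P Q * fderivWithin ℝ f (closure Ω) Q (exteriorNormal Ω Q))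
      (surfaceMeasure Ω) := by
  have := hΩ.isFiniteMeasure_surfaceMeasure
  obtain ⟨C, hC⟩ := hΩ.exists_bound_boundary hf μ k j P
  refine Integrable.of_bound (hΩ.aestronglyMeasurable_boundary hf μ k j P 0) C ?_
  filter_upwards [ae_mem_frontier_and_ne P] with Q hQ using hC 0 le_rfl zero_le_one Q hQ.1 hQ.2

/-- Green's second identity for the (singular) kernel `𝓗_{kj}`. -/
theorem integral_laplacian_kernelH_mul {f : E3 → ℝ} (hf : ContDiffOn ℝ 1 f (closure Ω))
    (hharm : HarmonicOnNhd f Ω) (μ : ℝ) (k j : Fin 3) (P : E3) :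
    ∫ Q in Ω, regKernelHLaplacian μ k j 0 P Q * f Q =
      ∫ Q, (fderiv ℝ (regKernelH μ k j 0 P) Q (exteriorNormal Ω Q) * f Q -
        regKernelH μ k j 0 P Q * fderivWithin ℝ f (closure Ω) Q (exteriorNormal Ω Q))
      ∂(surfaceMeasure Ω) := by
  have := hΩ.isFiniteMeasure_surfaceMeasure
  let ε : ℕ → ℝ := fun n => 1 / ((n : ℝ) + 1)
  have hε0 : ∀ n, 0 < ε n := fun n => by positivity
  have hε1 : ∀ n, ε n ≤ 1 := fun n => by
    rw [div_le_one (by positivity)]; linarith [(Nat.cast_nonneg n : (0 : ℝ) ≤ n)]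
  have hε : Tendsto ε atTop (𝓝 0) := tendsto_one_div_add_atTop_nhds_zero_nat
  obtain ⟨C₁, hC₁⟩ := hΩ.isCompact_closure.exists_bound_of_continuousOn hf.continuousOn
  obtain ⟨C, hC⟩ := hΩ.exists_bound_boundary hf μ k j P
  have step : ∀ n, ∫ Q in Ω, regKernelHLaplacian μ k j (ε n) P Q * f Q = _ := fun n => by
    have hpos := regRadius_pos_of_eps (hε0 n).ne' P
    have h2 := hΩ.integral_laplacian_mul hf hharm (h := regKernelH μ k j (ε n) P)
      (contDiff_iff_contDiffAt.2 fun Q => contDiffAt_regKernelH (hpos Q))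
    simp only [fun Q => laplacian_regKernelH (μ := μ) (k := k) (j := j) (hpos Q)] at h2
    exact h2
  -- Volume side: pointwise convergence off the pole, dominated by a multiple of `1/r`.
  have hL : Tendsto (fun n => ∫ Q in Ω, regKernelHLaplacian μ k j (ε n) P Q * f Q) atTop
      (𝓝 (∫ Q in Ω, regKernelHLaplacian μ k j 0 P Q * f Q)) := by
    refine tendsto_integral_of_dominated_convergence
      (fun Q => 1 / (32 * Real.pi * μ ^ 2) * (14 * ‖Q - P‖⁻¹) * C₁)
      (fun n => (hΩ.integrableOn_regKernelHLaplacian_mul hf.continuousOn μ k j (ε n)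
        P).aestronglyMeasurable)
      ((((integrableOn_inv_norm_sub hΩ.isBounded P).const_mul 14).const_mul _).mul_const C₁)
      (fun n => ?_) ?_
    · filter_upwards [ae_restrict_mem hΩ.isOpen.measurableSet, measure_eq_zero_iff_ae_notMem.1
        (measure_singleton (μ := volume.restrict Ω) P)] with Q hQ hQP
      rw [norm_mul]
      exact mul_le_mul (abs_regKernelHLaplacian_le μ k j (ε n) hQP) (hC₁ Q (subset_closure hQ))
        (norm_nonneg _) (by positivity)
    · filter_upwards [measure_eq_zero_iff_ae_notMem.1
        (measure_singleton (μ := volume.restrict Ω) P)] with Q hQ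
      exact (tendsto_regKernelHLaplacian hε hQ μ k j).mul_const _
  -- Boundary side: off the pole the derivative is given by an explicit formula that passes to the
  -- limit, and a constant dominates because the surface measure is finite.
  have hR := tendsto_integral_of_dominated_convergence (fun _ => C)
    (fun n => hΩ.aestronglyMeasurable_boundary hf μ k j P (ε n)) (integrable_const C)
    (fun n => by
      filter_upwards [ae_mem_frontier_and_ne P] with Q hQ
        using hC (ε n) (hε0 n).le (hε1 n) Q hQ.1 hQ.2)
    (by
      filter_upwards [ae_mem_frontier_and_ne P] with Q hQ
      have h1 := fun δ => fderiv_regKernelH (μ := μ) (k := k) (j := j)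
        (regRadius_pos_of_ne δ hQ.2) (exteriorNormal Ω Q)
      simp only [h1]
      exact ((tendsto_regKernelHDeriv hε hQ.2 μ k j _).mul_const _).sub
        ((tendsto_regKernelH hε hQ.2 μ k j).mul_const _))
  simp only [step] at hL
  rw [tendsto_nhds_unique hL hR]
  refine integral_congr_ae ?_
  filter_upwards [ae_mem_frontier_and_ne P] with Q hQ
  rw [fderiv_regKernelH (regRadius_pos_of_ne 0 hQ.2)]

end IsLipschitzDomain

/-! ### The Stokeslet integrands and the zero extension. -/

/-- At `ε = 0` the Laplacian formula is `(4 / 32πμ²)(δ_{kj}/r + R_k R_j/r³)`. At the pole both sides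
are `0`, division by zero being zero. -/
lemma stokeslet_eq_mul_regKernelHLaplacian {μ : ℝ} (hμ : μ ≠ 0) (k j : Fin 3) (Q P : E3) :
    stokeslet μ k j Q P = μ * regKernelHLaplacian μ k j 0 P Q := by
  rw [stokeslet, regKernelHLaplacian, regRadius_zero]
  rcases eq_or_ne ‖Q - P‖ 0 with h | h
  · simp [h]
  · field_simp
    ring

lemma volumeIntegrand_eq {μ : ℝ} (hμ : μ ≠ 0) (f : E3 → E3) (k : Fin 3) (P Q : E3) :
    volumeIntegrand μ f k P Q = μ * ∑ j, regKernelHLaplacian μ k j 0 P Q * f Q j := by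
  simp only [volumeIntegrand, stokeslet_eq_mul_regKernelHLaplacian hμ, Finset.mul_sum, mul_assoc]

/-- The pole is excluded because the closed formula is derived only where the kernel is `C²`; it is
a null set for the integrals. -/
lemma laplacianIntegrand_eq (μ : ℝ) (f : E3 → E3) (k : Fin 3) {P Q : E3} (hQ : Q ≠ P) :
    laplacianIntegrand μ f k P Q = ∑ j, regKernelHLaplacian μ k j 0 P Q * f Q j := by
  simp only [laplacianIntegrand, ← regKernelH_zero, ← laplacian_regKernelH (regRadius_pos_of_ne 0 hQ)]

lemma volumeIntegrand_eq_add (μ : ℝ) (f g : E3 → E3) (k : Fin 3) (P Q : E3) :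
    volumeIntegrand μ f k P Q =
      volumeIntegrand μ g k P Q + volumeIntegrand μ (fun Q => f Q - g Q) k P Q := by
  simp only [volumeIntegrand, ← Finset.sum_add_distrib, PiLp.sub_apply]
  exact Finset.sum_congr rfl fun j _ => by ring

lemma volumeIntegrand_eq_zero {μ : ℝ} {f : E3 → E3} {k : Fin 3} {P Q : E3} (h : f Q = 0) :
    volumeIntegrand μ f k P Q = 0 := by
  simp [volumeIntegrand, h]

lemma continuousAt_stokeslet (μ : ℝ) (k j : Fin 3) {P Q : E3} (hQ : Q ≠ P) :
    ContinuousAt (fun Q => stokeslet μ k j Q P) Q := by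
  have h : ‖Q - P‖ ≠ 0 := norm_ne_zero_iff.2 (sub_ne_zero.2 hQ)
  unfold stokeslet
  refine continuousAt_const.mul (ContinuousAt.add ?_ ?_)
  · exact continuousAt_const.div (by fun_prop) h
  · exact ContinuousAt.div (by fun_prop) (by fun_prop) (pow_ne_zero 3 h)

lemma continuousAt_volumeIntegrand (μ : ℝ) {f : E3 → E3} (k : Fin 3) {P Q : E3}
    (hf : ContinuousAt f Q) (hQ : Q ≠ P) : ContinuousAt (volumeIntegrand μ f k P) Q := by
  unfold volumeIntegrand
  refine tendsto_finsetSum _ fun j _ => ?_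
  exact (continuousAt_stokeslet μ k j hQ).mul
    ((EuclideanSpace.proj (𝕜 := ℝ) j).continuous.continuousAt.comp hf)

lemma zeroExtension_eqOn_closure {Ω : Set E3} (hΩ : IsOpen Ω) {F F₀ : E3 → E3}
    (h : ∀ Q ∈ frontier Ω, F₀ Q = F Q) {Q : E3} (hQ : Q ∈ closure Ω) :
    zeroExtension Ω F F₀ Q = F Q - F₀ Q := by
  by_cases hQ' : Q ∈ Ω
  · exact indicator_of_mem hQ' _
  · rw [zeroExtension, indicator_of_notMem hQ', h Q (hΩ.frontier_eq ▸ ⟨hQ, hQ'⟩), sub_self]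

lemma continuous_zeroExtension {Ω : Set E3} {F F₀ : E3 → E3} (hF : ContinuousOn F (closure Ω))
    (hF₀ : ContinuousOn F₀ (closure Ω)) (h : ∀ Q ∈ frontier Ω, F₀ Q = F Q) :
    Continuous (zeroExtension Ω F F₀) :=
  continuous_indicator (fun Q hQ => by rw [h Q hQ, sub_self]) (hF.sub hF₀)

lemma volumeIntegrand_zeroExtension (Ω : Set E3) (μ : ℝ) (F F₀ : E3 → E3) (k : Fin 3) (P : E3) :
    volumeIntegrand μ (zeroExtension Ω F F₀) k P =
      Ω.indicator (volumeIntegrand μ (fun Q => F Q - F₀ Q) k P) := by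
  ext Q
  by_cases hQ : Q ∈ Ω <;> simp [volumeIntegrand, zeroExtension, hQ]

namespace IsLipschitzDomain


lemma continuousOn_coord {f : E3 → E3} {s : Set E3} (hf : ContinuousOn f s) (j : Fin 3) :
    ContinuousOn (fun Q => f Q j) s :=
  (EuclideanSpace.proj (𝕜 := ℝ) j).continuous.comp_continuousOn hf

lemma integrableOn_sum_regKernelHLaplacian_mul (hΩ : IsLipschitzDomain Ω) {f : E3 → E3}
    (hf : ContinuousOn f (closure Ω)) (μ : ℝ) (k : Fin 3) (P : E3) :
    IntegrableOn (fun Q => ∑ j, regKernelHLaplacian μ k j 0 P Q * f Q j) Ω :=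
  integrable_finsetSum _ fun j _ =>
    hΩ.integrableOn_regKernelHLaplacian_mul (continuousOn_coord hf j) μ k j 0 P

lemma integrableOn_volumeIntegrand (hΩ : IsLipschitzDomain Ω) {μ : ℝ} (hμ : μ ≠ 0) {f : E3 → E3}
    (hf : ContinuousOn f (closure Ω)) (k : Fin 3) (P : E3) :
    IntegrableOn (volumeIntegrand μ f k P) Ω := by
  rw [funext (volumeIntegrand_eq hμ f k P)]
  exact (hΩ.integrableOn_sum_regKernelHLaplacian_mul hf μ k P).const_mul μ

lemma laplacianIntegrand_ae_eq (Ω : Set E3) (μ : ℝ) (f : E3 → E3) (k : Fin 3) (P : E3) :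
    laplacianIntegrand μ f k P =ᵐ[volume.restrict Ω]
      fun Q => ∑ j, regKernelHLaplacian μ k j 0 P Q * f Q j := by
  filter_upwards [measure_eq_zero_iff_ae_notMem.1
    (measure_singleton (μ := volume.restrict Ω) P)] with Q hQ
  exact laplacianIntegrand_eq μ f k hQ

lemma integrableOn_laplacianIntegrand (hΩ : IsLipschitzDomain Ω) {f : E3 → E3}
    (hf : ContinuousOn f (closure Ω)) (μ : ℝ) (k : Fin 3) (P : E3) :
    IntegrableOn (laplacianIntegrand μ f k P) Ω :=
  (hΩ.integrableOn_sum_regKernelHLaplacian_mul hf μ k P).congr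
    (laplacianIntegrand_ae_eq Ω μ f k P).symm

lemma integral_volumeIntegrand {μ : ℝ} (hμ : μ ≠ 0) (Ω : Set E3) (f : E3 → E3) (k : Fin 3)
    (P : E3) :
    ∫ Q in Ω, volumeIntegrand μ f k P Q = μ * ∫ Q in Ω, laplacianIntegrand μ f k P Q := by
  rw [integral_congr_ae (laplacianIntegrand_ae_eq Ω μ f k P), ← integral_const_mul]
  simp only [volumeIntegrand_eq hμ]

/-- Taking a coordinate commutes with the derivative within the closure because that derivative is
unique there. -/
lemma normalDeriv_apply (hΩ : IsLipschitzDomain Ω) {f : E3 → E3}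
    (hf : ContDiffOn ℝ 1 f (closure Ω)) {Q : E3} (hQ : Q ∈ closure Ω) (j : Fin 3) :
    normalDeriv Ω f Q j =
      fderivWithin ℝ (fun y => f y j) (closure Ω) Q (exteriorNormal Ω Q) := by
  have h := (EuclideanSpace.proj (𝕜 := ℝ) j).hasFDerivAt.comp_hasFDerivWithinAt Q
    ((hf.differentiableOn one_ne_zero) Q hQ).hasFDerivWithinAt
  have h' := h.fderivWithin (hΩ.uniqueDiffOn_closure Q hQ)
  exact (congrArg (fun L : E3 →L[ℝ] ℝ => L (exteriorNormal Ω Q)) h').symm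

lemma boundaryIntegrand_ae_eq (hΩ : IsLipschitzDomain Ω) {f : E3 → E3}
    (hf : ContDiffOn ℝ 1 f (closure Ω)) (μ : ℝ) (k : Fin 3) (P : E3) :
    boundaryIntegrand Ω μ f k P =ᵐ[surfaceMeasure Ω] fun Q => ∑ j : Fin 3,
      (fderiv ℝ (regKernelH μ k j 0 P) Q (exteriorNormal Ω Q) * f Q j -
        regKernelH μ k j 0 P Q *
          fderivWithin ℝ (fun y => f y j) (closure Ω) Q (exteriorNormal Ω Q)) := by
  filter_upwards [ae_mem_frontier_and_ne P] with Q hQ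
  refine Finset.sum_congr rfl fun j _ => ?_
  rw [hΩ.normalDeriv_apply hf (frontier_subset_closure hQ.1), ← regKernelH_zero, normalDerivH,
    ← funext (regKernelH_zero μ k j P)]

lemma contDiffOn_coord {f : E3 → E3} {s : Set E3} (hf : ContDiffOn ℝ 1 f s) (j : Fin 3) :
    ContDiffOn ℝ 1 (fun Q => f Q j) s :=
  (EuclideanSpace.proj (𝕜 := ℝ) j).contDiff.comp_contDiffOn hf

lemma integrable_boundaryIntegrand (hΩ : IsLipschitzDomain Ω) {f : E3 → E3}
    (hf : ContDiffOn ℝ 1 f (closure Ω)) (μ : ℝ) (k : Fin 3) (P : E3) :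
    Integrable (boundaryIntegrand Ω μ f k P) (surfaceMeasure Ω) :=
  (integrable_finsetSum _ fun j _ =>
    hΩ.integrable_boundary (contDiffOn_coord hf j) μ k j P).congr
    (hΩ.boundaryIntegrand_ae_eq hf μ k P).symm

theorem integral_laplacianIntegrand (hΩ : IsLipschitzDomain Ω) {f : E3 → E3}
    (hf : ContDiffOn ℝ 1 f (closure Ω)) (hharm : HarmonicOnNhd f Ω) (μ : ℝ) (k : Fin 3) (P : E3) :
    ∫ Q in Ω, laplacianIntegrand μ f k P Q =
      ∫ Q, boundaryIntegrand Ω μ f k P Q ∂(surfaceMeasure Ω) := by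
  rw [integral_congr_ae (laplacianIntegrand_ae_eq Ω μ f k P),
    integral_congr_ae (hΩ.boundaryIntegrand_ae_eq hf μ k P),
    integral_finsetSum _ fun j _ =>
      hΩ.integrableOn_regKernelHLaplacian_mul (continuousOn_coord hf.continuousOn j) μ k j 0 P,
    integral_finsetSum _ fun j _ => hΩ.integrable_boundary (contDiffOn_coord hf j) μ k j P]
  exact Finset.sum_congr rfl fun j _ => hΩ.integral_laplacian_kernelH_mul
    (contDiffOn_coord hf j) (hharm.comp_CLM (EuclideanSpace.proj (𝕜 := ℝ) j)) μ k j P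

end IsLipschitzDomain

end

/-! ### Assembly of the main theorem. -/

theorem mainTheorem3
    (Ω : Set E3) (hΩ : IsLipschitzDomain Ω)
    (μ : ℝ) (hμ : 0 < μ)
    (F F₀ : E3 → E3)
    (hF : ContinuousOn F (closure Ω))
    (hF₀ : ContDiffOn ℝ 1 F₀ (closure Ω))
    (hharm : HarmonicOnNhd F₀ Ω)
    (hbdry : ∀ Q ∈ frontier Ω, F₀ Q = F Q) :
    -- the exterior unit normal exists almost everywhere on the boundary
    (∀ᵐ Q ∂(surfaceMeasure Ω), IsExteriorUnitNormal Ω Q (exteriorNormal Ω Q)) ∧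
    (∀ (P : E3) (k : Fin 3),
      -- all the integrals converge
      IntegrableOn (volumeIntegrand μ F k P) Ω ∧
      IntegrableOn (laplacianIntegrand μ F₀ k P) Ω ∧
      IntegrableOn (volumeIntegrand μ (fun Q => F Q - F₀ Q) k P) Ω ∧
      Integrable (boundaryIntegrand Ω μ F₀ k P) (surfaceMeasure Ω) ∧
      -- splitting of the volume integral
      (∫ Q in Ω, volumeIntegrand μ F k P Q) =
        μ * (∫ Q in Ω, laplacianIntegrand μ F₀ k P Q)
          + (∫ Q in Ω, volumeIntegrand μ (fun Q => F Q - F₀ Q) k P Q) ∧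
      -- reduction of the first term to a boundary integral
      μ * (∫ Q in Ω, laplacianIntegrand μ F₀ k P Q) =
        μ * (∫ Q, boundaryIntegrand Ω μ F₀ k P Q ∂(surfaceMeasure Ω)) ∧
      (∫ Q in Ω, volumeIntegrand μ F k P Q) =
        μ * (∫ Q, boundaryIntegrand Ω μ F₀ k P Q ∂(surfaceMeasure Ω))
          + (∫ Q in Ω, volumeIntegrand μ (fun Q => F Q - F₀ Q) k P Q) ∧
      -- the remainder integrand vanishes on the boundary, and its extension by zero is continuous
      -- away from the pole
      (∀ Q ∈ frontier Ω, volumeIntegrand μ (fun Q => F Q - F₀ Q) k P Q = 0) ∧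
      ContinuousOn (volumeIntegrand μ (zeroExtension Ω F F₀) k P) {P}ᶜ ∧
      (P ∉ closure Ω → Continuous (volumeIntegrand μ (zeroExtension Ω F F₀) k P)) ∧
      -- the remainder as an integral over any covering box
      (∀ a b : E3, Ω ⊆ closedBox a b →
        IntegrableOn (volumeIntegrand μ (zeroExtension Ω F F₀) k P) (closedBox a b) ∧
        (∫ Q in closedBox a b, volumeIntegrand μ (zeroExtension Ω F F₀) k P Q) =
          ∫ Q in Ω, volumeIntegrand μ (fun Q => F Q - F₀ Q) k P Q)) ∧
    -- the zero extension of `F - F₀` is a continuous extension from the closure to all of space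
    (∀ Q ∈ closure Ω, zeroExtension Ω F F₀ Q = F Q - F₀ Q) ∧
    Continuous (zeroExtension Ω F F₀) := by
  have hF₀c := hF₀.continuousOn
  have hD : ContinuousOn (fun Q => F Q - F₀ Q) (closure Ω) := hF.sub hF₀c
  have hZ := continuous_zeroExtension hF hF₀c hbdry
  refine ⟨hΩ.ae_isExteriorUnitNormal, fun P k => ?_,
    fun Q hQ => zeroExtension_eqOn_closure hΩ.isOpen hbdry hQ, hZ⟩
  have hIF := hΩ.integrableOn_volumeIntegrand hμ.ne' hF k P
  have hIF₀ := hΩ.integrableOn_volumeIntegrand hμ.ne' hF₀c k P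
  have hID := hΩ.integrableOn_volumeIntegrand hμ.ne' hD k P
  have hsplit : (∫ Q in Ω, volumeIntegrand μ F k P Q) =
      μ * (∫ Q in Ω, laplacianIntegrand μ F₀ k P Q)
        + (∫ Q in Ω, volumeIntegrand μ (fun Q => F Q - F₀ Q) k P Q) := by
    rw [← IsLipschitzDomain.integral_volumeIntegrand hμ.ne', ← integral_add hIF₀ hID]
    simp only [← volumeIntegrand_eq_add]
  have hgreen := congrArg (μ * ·) (hΩ.integral_laplacianIntegrand hF₀ hharm μ k P)
  have hext := volumeIntegrand_zeroExtension Ω μ F F₀ k P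
  refine ⟨hIF, hΩ.integrableOn_laplacianIntegrand hF₀c μ k P, hID,
    hΩ.integrable_boundaryIntegrand hF₀ μ k P, hsplit, hgreen, hgreen ▸ hsplit,
    fun Q hQ => volumeIntegrand_eq_zero (by rw [hbdry Q hQ, sub_self]),
    fun Q hQ => (continuousAt_volumeIntegrand μ k hZ.continuousAt hQ).continuousWithinAt,
    fun hP => continuous_iff_continuousAt.2 fun Q => ?_, fun a b hab => ⟨?_, ?_⟩⟩
  · rcases eq_or_ne Q P with rfl | hQ
    -- When the pole is outside the closure, the extended integrand is zero on a whole neighbourhood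
    -- of it.
    · have h : volumeIntegrand μ (zeroExtension Ω F F₀) k Q =ᶠ[nhds Q] fun _ => 0 := by
        filter_upwards [isClosed_closure.isOpen_compl.mem_nhds hP] with y hy
        rw [hext, Set.indicator_of_notMem fun hy' => hy (subset_closure hy')]
      exact continuousAt_const.congr h.symm
    · exact continuousAt_volumeIntegrand μ k hZ.continuousAt hQ
  · rw [hext]
    exact ((integrable_indicator_iff hΩ.isOpen.measurableSet).2 hID).integrableOn
  · rw [hext, setIntegral_indicator hΩ.isOpen.measurableSet, Set.inter_eq_right.2 hab]
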